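/- Let $\Omega\subset\mathbb R^3$ be a bounded, connected, nonempty open set with Lipschitz boundary. All functions are real-valued, $u_{,i}$ denotes a weak partial derivative, and repeated indices are summed over $1,2,3$. Let $P^1$ be the space of polynomials of degree at most one on $\Omega$, and fix any continuous linear projection $\pi_P$ of $W^{2,2}(\Omega)$ onto $P^1$. Identify $\dot W^{2,2}(\Omega)=W^{2,2}(\Omega)/P^1$ with $\ker\pi_P\subset W^{2,2}(\Omega)$, with inner product $\langle\psi,\psi'\rangle=\int_\Omega\psi_{,ij}\psi'_{,ij}\,dV$, and identify $\dot W^{1,2}(\Omega)^3=(W^{1,2}(\Omega)/\mathbb R)^3$ with the mean-zero vector fields in $W^{1,2}(\Omega)^3$, with inner product $\langle w,\varphi\rangle=\int_\Omega w_{i,j}\varphi_{i,j}\,dV$. Let $\dot\nabla:\dot W^{2,2}(\Omega)\to\dot W^{1,2}(\Omega)^3$ be the norm-preserving map that sends $\psi$ to the mean-zero representative of $\nabla\psi$, with dual map $\dot\nabla^*$. Every $\psi\in\dot W^{2,2}(\Omega)$ has a representative that is continuous on $\overline\Omega$, and $\delta(\psi)=(\psi|_\Omega,\psi|_{\partial\Omega})$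 defines a bounded linear map from $\dot W^{2,2}(\Omega)$ to the pairs of bounded continuous functions on $\Omega$ and on $\partial\Omega$. There are bounded linear maps $\delta^{\mathsf T}$ (from pairs of bounded functionals on these function spaces to $\dot W^{2,2}(\Omega)$) and $\dot\nabla^{\mathsf T}:\dot W^{1,2}(\Omega)^3\to\dot W^{2,2}(\Omega)$ with $\langle\delta^{\mathsf T}(F),\psi\rangle=\delta^*(F)(\psi)$ and $\langle\dot\nabla^{\mathsf T}(w),\psi\rangle=\langle w,\dot\nabla\psi\rangle$ for all $\psi\in\dot W^{2,2}(\Omega)$. Let $\beta$ and $\tau$ be finite signed Borel (Radon) measures on $\Omega$ and $\partial\Omega$, let $\hat\beta,\hat\tau$ be the functionals of integration against them, so that $\delta^*(\hat\beta,\hat\tau)(\psi)=\int_\Omega\psi\,d\beta+\int_{\partial\Omega}\psi\,d\tau$. A field $w\in\dot W^{1,2}(\Omega)^3$ satisfies the weak balance equation if $\delta^*(\hat\beta,\hat\tau)=\dot\nabla^*(\langle w,\cdot\rangle)$ or, equivalently, if $\delta^{\mathsf T}(\hat\beta,\hat\tau)=\dot\nabla^{\mathsf T}(w)$. Then there is a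 unique $\overline w^{\mathrm{opt}}\in\dot W^{1,2}(\Omega)^3$ that satisfies the weak balance equation and minimizes the dissipation $\int_\Omega w_{i,j}w_{i,j}\,dV$ among all its solutions. Moreover, the optimal value $$\omega_{(\beta,\tau)}:=\inf\Bigl\{\|w\|_{\dot W^{1,2}(\Omega)^3}=\Bigl[\int_\Omega w_{i,j}w_{i,j}\,dV\Bigr]^{1/2}\;:\;w\in\dot W^{1,2}(\Omega)^3,\ \delta^*(\hat\beta,\hat\tau)=\dot\nabla^*(\langle w,\cdot\rangle)\Bigr\}$$ satisfies $\omega_{(\beta,\tau)}^2=\int_\Omega\overline w^{\mathrm{opt}}_{i,j}\overline w^{\mathrm{opt}}_{i,j}\,dV$ and $$\omega_{(\beta,\tau)}=\|\overline w^{\mathrm{opt}}\|_{\dot W^{1,2}(\Omega)^3}=\|\delta^*(\hat\beta,\hat\tau)\|_{\dot W^{2,2}(\Omega)^*}=\sup\left\{\frac{\int_\Omega\psi\,d\beta+\int_{\partial\Omega}\psi\,d\tau}{\bigl[\int_\Omega\psi_{,ij}\psi_{,ij}\,dV\bigr]^{1/2}}\;:\;\psi\in\dot W^{2,2}(\Omega),\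 \psi\neq0\right\}.$$ -/

import Mathlib

open MeasureTheory Topology
open scoped ContDiff BoundedContinuousFunction

noncomputable section

namespace FluxOpt

/-- Euclidean three-space. -/
abbrev E3 : Type := EuclideanSpace ℝ (Fin 3)

/-- Near each boundary point the open set is, in suitable orthonormal coordinates, the region
strictly above the graph of a Lipschitz function of the first two coordinates. -/
def HasLipschitzBoundary (U : Set E3) : Prop :=
  ∀ x₀ ∈ frontier U, ∃ r : ℝ, 0 < r ∧ ∃ (e : E3 ≃ₗᵢ[ℝ] E3) (K : NNReal)
    (γ : EuclideanSpace ℝ (Fin 2) → ℝ), LipschitzWith K γ ∧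
      ∀ x ∈ Metric.ball x₀ r, (x ∈ U ↔ γ !₂[e x 0, e x 1] < e x 2)

/-- A bounded (nonempty, connected, open) domain in three-space with Lipschitz boundary. -/
structure LipschitzDomain where
  /-- the underlying open set -/
  carrier : TopologicalSpace.Opens E3
  isBounded : Bornology.IsBounded (carrier : Set E3)
  isConnected : IsConnected (carrier : Set E3)
  lipschitz : HasLipschitzBoundary (carrier : Set E3)

/-- The domain as a set. -/
abbrev LipschitzDomain.set (Ω : LipschitzDomain) : Set E3 := (Ω.carrier : Set E3)

/-- Lebesgue measure on the domain. -/
abbrev LipschitzDomain.vol (Ω : LipschitzDomain) : Measure E3 := volume.restrict Ω.set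

instance (Ω : LipschitzDomain) : IsFiniteMeasure Ω.vol :=
  ⟨by
    rw [Measure.restrict_apply_univ]
    exact Ω.isBounded.measure_lt_top⟩

/-- Real `L²(Ω)`. -/
abbrev L2 (Ω : LipschitzDomain) : Type := Lp ℝ 2 Ω.vol

variable {Ω : LipschitzDomain}

/-! ### Weak derivatives and Sobolev spaces -/

/-- `v` is the weak (distributional) derivative of `u` on `Ω` in the `i`-th direction. -/
def HasWeakDeriv (i : Fin 3) (u v : L2 Ω) : Prop :=
  ∀ φ : E3 → ℝ, ContDiff ℝ ∞ φ → HasCompactSupport φ → tsupport φ ⊆ Ω.set →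
    ∫ x in Ω.set, u x * fderiv ℝ φ x (EuclideanSpace.single i 1) = -∫ x in Ω.set, v x * φ x

theorem integrable_mul_test (u : L2 Ω) {φ : E3 → ℝ} (hφ : Continuous φ)
    (hc : HasCompactSupport φ) : Integrable (fun x => u x * φ x) Ω.vol := by
  obtain ⟨C, hC⟩ := hc.exists_bound_of_continuous hφ
  exact ((Lp.memLp u).integrable (by norm_num)).mul_bdd (c := C)
    hφ.aestronglyMeasurable (Filter.Eventually.of_forall hC)

theorem integrable_mul_fderiv (i : Fin 3) (u : L2 Ω) {φ : E3 → ℝ} (hφ : ContDiff ℝ ∞ φ)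
    (hc : HasCompactSupport φ) :
    Integrable (fun x => u x * fderiv ℝ φ x (EuclideanSpace.single i 1)) Ω.vol := by
  refine integrable_mul_test u ?_ ?_
  · exact (hφ.continuous_fderiv (by simp)).clm_apply continuous_const
  · exact hc.fderiv_apply ℝ _

theorem HasWeakDeriv.add {i : Fin 3} {u v u' v' : L2 Ω} (h : HasWeakDeriv i u v)
    (h' : HasWeakDeriv i u' v') : HasWeakDeriv i (u + u') (v + v') := by
  intro φ hφ hc hs
  have e1 : ∫ x in Ω.set, (u + u') x * fderiv ℝ φ x (EuclideanSpace.single i 1)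
      = ∫ x in Ω.set, (u x * fderiv ℝ φ x (EuclideanSpace.single i 1)
        + u' x * fderiv ℝ φ x (EuclideanSpace.single i 1)) := by
    refine integral_congr_ae ?_
    filter_upwards [Lp.coeFn_add u u'] with x hx
    rw [hx, Pi.add_apply, add_mul]
  have e2 : ∫ x in Ω.set, (v + v') x * φ x = ∫ x in Ω.set, (v x * φ x + v' x * φ x) := by
    refine integral_congr_ae ?_
    filter_upwards [Lp.coeFn_add v v'] with x hx
    rw [hx, Pi.add_apply, add_mul]
  rw [e1, e2, integral_add (integrable_mul_fderiv i u hφ hc) (integrable_mul_fderiv i u' hφ hc),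
    integral_add (integrable_mul_test v hφ.continuous hc)
      (integrable_mul_test v' hφ.continuous hc), h φ hφ hc hs, h' φ hφ hc hs, neg_add]

theorem HasWeakDeriv.smul {i : Fin 3} {u v : L2 Ω} (c : ℝ) (h : HasWeakDeriv i u v) :
    HasWeakDeriv i (c • u) (c • v) := by
  intro φ hφ hc hs
  have e1 : ∫ x in Ω.set, (c • u) x * fderiv ℝ φ x (EuclideanSpace.single i 1)
      = ∫ x in Ω.set, c * (u x * fderiv ℝ φ x (EuclideanSpace.single i 1)) := by
    refine integral_congr_ae ?_
    filter_upwards [Lp.coeFn_smul c u] with x hx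
    rw [hx, Pi.smul_apply, smul_eq_mul, mul_assoc]
  have e2 : ∫ x in Ω.set, (c • v) x * φ x = ∫ x in Ω.set, c * (v x * φ x) := by
    refine integral_congr_ae ?_
    filter_upwards [Lp.coeFn_smul c v] with x hx
    rw [hx, Pi.smul_apply, smul_eq_mul, mul_assoc]
  rw [e1, e2, integral_const_mul, integral_const_mul, h φ hφ hc hs, mul_neg]

theorem HasWeakDeriv.unique {i : Fin 3} {u v v' : L2 Ω} (h : HasWeakDeriv i u v)
    (h' : HasWeakDeriv i u v') : v = v' := by
  have hloc : LocallyIntegrableOn (fun x => v x - v' x) Ω.set volume := by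
    have h1 : IntegrableOn (fun x => v x - v' x) Ω.set volume :=
      ((Lp.memLp v).integrable (by norm_num)).sub ((Lp.memLp v').integrable (by norm_num))
    exact h1.locallyIntegrableOn
  have key := Ω.carrier.isOpen.ae_eq_zero_of_integral_contDiff_smul_eq_zero hloc (by
    intro g hg hc hs
    have hz : ∀ x, x ∉ Ω.set → g x • (v x - v' x) = 0 := by
      intro x hx
      rw [image_eq_zero_of_notMem_tsupport (fun hx' => hx (hs hx')), zero_smul]
    rw [← setIntegral_eq_integral_of_forall_compl_eq_zero hz]
    have e : ∫ x in Ω.set, g x • (v x - v' x) = ∫ x in Ω.set, (v x * g x - v' x * g x) := by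
      refine integral_congr_ae (Filter.Eventually.of_forall fun x => ?_)
      simp only [smul_eq_mul]
      ring
    rw [e, integral_sub (integrable_mul_test v hg.continuous hc)
      (integrable_mul_test v' hg.continuous hc)]
    have a := h g hg hc hs
    have b := h' g hg hc hs
    linarith)
  refine Lp.ext ?_
  have := (ae_restrict_iff' Ω.carrier.isOpen.measurableSet).2 key
  filter_upwards [this] with x hx
  exact sub_eq_zero.1 hx

theorem hasWeakDeriv_zero (i : Fin 3) : HasWeakDeriv i (0 : L2 Ω) 0 := by
  have e (g : E3 → ℝ) : ∫ x in Ω.set, (0 : L2 Ω) x * g x = 0 := by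
    rw [← integral_zero E3 ℝ]
    refine integral_congr_ae ?_
    filter_upwards [Lp.coeFn_zero ℝ 2 Ω.vol] with x hx
    rw [hx, Pi.zero_apply, zero_mul]
  intro φ _ _ _
  rw [e, e, neg_zero]

variable (Ω) in
/-- The Sobolev space `W^{1,2}(Ω)`. -/
def W12 : Submodule ℝ (L2 Ω) where
  carrier := {u | ∀ i, ∃ v, HasWeakDeriv i u v}
  add_mem' hu hu' i := ⟨_, (hu i).choose_spec.add (hu' i).choose_spec⟩
  zero_mem' i := ⟨0, hasWeakDeriv_zero i⟩
  smul_mem' c _ hu i := ⟨_, (hu i).choose_spec.smul c⟩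

/-- The weak derivative `u ↦ u_{,i}` on `W^{1,2}(Ω)`. -/
def weakDeriv (i : Fin 3) : W12 Ω →ₗ[ℝ] L2 Ω where
  toFun u := (u.2 i).choose
  map_add' u u' := ((u + u').2 i).choose_spec.unique
    ((u.2 i).choose_spec.add (u'.2 i).choose_spec)
  map_smul' c u := ((c • u).2 i).choose_spec.unique ((u.2 i).choose_spec.smul c)

theorem hasWeakDeriv_weakDeriv (i : Fin 3) (u : W12 Ω) :
    HasWeakDeriv i (u : L2 Ω) (weakDeriv i u) := (u.2 i).choose_spec

variable (Ω) in
/-- The Sobolev space `W^{2,2}(Ω)`, as a subspace of `W^{1,2}(Ω)`: all first weak derivatives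
lie again in `W^{1,2}(Ω)`. -/
def W22 : Submodule ℝ (W12 Ω) := ⨅ i, (W12 Ω).comap (weakDeriv i)

/-- The gradient component `ψ ↦ ψ_{,i}`, from `W^{2,2}(Ω)` to `W^{1,2}(Ω)`. -/
def gradW (i : Fin 3) : W22 Ω →ₗ[ℝ] W12 Ω :=
  ((weakDeriv i).comp (W22 Ω).subtype).codRestrict (W12 Ω)
    (fun u => (Submodule.mem_iInf _).1 u.2 i)

/-- The second weak derivative `ψ ↦ ψ_{,ij}` on `W^{2,2}(Ω)`. -/
def hessW (i j : Fin 3) : W22 Ω →ₗ[ℝ] L2 Ω := (weakDeriv j).comp (gradW i)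

/-- The function underlying an element of `W^{2,2}(Ω)`. -/
def W22.toL2 : W22 Ω →ₗ[ℝ] L2 Ω := (W12 Ω).subtype.comp (W22 Ω).subtype

/-- The norm of `W^{2,2}(Ω)`. -/
def sobolevNorm (u : W22 Ω) : ℝ :=
  ‖W22.toL2 u‖ + ∑ i, ‖(gradW i u : L2 Ω)‖ + ∑ i, ∑ j, ‖hessW i j u‖

/-! ### The spaces `Ẇ^{2,2}(Ω)` and `Ẇ^{1,2}(Ω)³` -/

/-- `π` is a continuous linear projection of `W^{2,2}(Ω)` onto the space `P¹` of polynomials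
of degree at most one. -/
structure IsAffineProjection (π : W22 Ω →ₗ[ℝ] W22 Ω) : Prop where
  affine : ∀ u, ∃ (a : ℝ) (b : E3), W22.toL2 (π u) =ᵐ[Ω.vol] fun x => a + inner ℝ b x
  fix : ∀ u, (∃ (a : ℝ) (b : E3), W22.toL2 u =ᵐ[Ω.vol] fun x => a + inner ℝ b x) → π u = u
  bounded : ∃ C : ℝ, ∀ u, sobolevNorm (π u) ≤ C * sobolevNorm u

/-- `Ẇ^{2,2}(Ω)`: the quotient `W^{2,2}(Ω)/P¹` identified with the kernel of the projection `π`. -/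
def DotW22 (π : W22 Ω →ₗ[ℝ] W22 Ω) : Type := ↥(LinearMap.ker π)

/-- The mean-zero elements of `W^{1,2}(Ω)`. -/
def meanZero (Ω : LipschitzDomain) : Submodule ℝ (W12 Ω) where
  carrier := {u | ∫ x in Ω.set, (u : L2 Ω) x = 0}
  zero_mem' := by
    change ∫ x in Ω.set, (0 : L2 Ω) x = 0
    rw [← integral_zero E3 ℝ]
    exact integral_congr_ae (Lp.coeFn_zero ℝ 2 Ω.vol)
  add_mem' {u v} hu hv := by
    change ∫ x in Ω.set, ((u : L2 Ω) + (v : L2 Ω)) x = 0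
    rw [integral_congr_ae (Lp.coeFn_add (u : L2 Ω) (v : L2 Ω))]
    simp only [Pi.add_apply]
    rw [integral_add ((Lp.memLp _).integrable (by norm_num))
      ((Lp.memLp _).integrable (by norm_num)), hu, hv, add_zero]
  smul_mem' c u hu := by
    change ∫ x in Ω.set, (c • (u : L2 Ω)) x = 0
    rw [integral_congr_ae (Lp.coeFn_smul c (u : L2 Ω))]
    simp only [Pi.smul_apply]
    rw [integral_smul, hu, smul_zero]

/-- `Ẇ^{1,2}(Ω)³`: the quotient `(W^{1,2}(Ω)/ℝ)³`, identified with the space of mean-zero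
vector fields. -/
def DotW12Vec (Ω : LipschitzDomain) : Type := Fin 3 → ↥(meanZero Ω)

section instances

variable {π : W22 Ω →ₗ[ℝ] W22 Ω}

instance : AddCommGroup (DotW22 π) := inferInstanceAs (AddCommGroup ↥(LinearMap.ker π))
instance : Module ℝ (DotW22 π) := inferInstanceAs (Module ℝ ↥(LinearMap.ker π))
instance : AddCommGroup (DotW12Vec Ω) := inferInstanceAs (AddCommGroup (Fin 3 → ↥(meanZero Ω)))
instance : Module ℝ (DotW12Vec Ω) := inferInstanceAs (Module ℝ (Fin 3 → ↥(meanZero Ω)))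

/-- The inclusion of `Ẇ^{2,2}(Ω)` in `W^{2,2}(Ω)`. -/
def DotW22.incl : DotW22 π →ₗ[ℝ] W22 Ω := (LinearMap.ker π).subtype

/-- The `i`-th component `wᵢ` of a flux field. -/
def DotW12Vec.comp (i : Fin 3) : DotW12Vec Ω →ₗ[ℝ] W12 Ω :=
  (meanZero Ω).subtype.comp (LinearMap.proj i)

/-- The derivative `w_{i,j}` of a flux field. -/
def DotW12Vec.deriv (i j : Fin 3) : DotW12Vec Ω →ₗ[ℝ] L2 Ω := (weakDeriv j).comp (comp i)

/-- The family of second derivatives `(ψ_{,ij})`. -/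
def DotW22.hess : DotW22 π →ₗ[ℝ] PiLp 2 (fun _ : Fin 3 × Fin 3 => L2 Ω) :=
  (WithLp.linearEquiv 2 ℝ (Fin 3 × Fin 3 → L2 Ω)).symm.toLinearMap.comp
    (LinearMap.pi fun p => (hessW p.1 p.2).comp DotW22.incl)

/-- The family of derivatives `(w_{i,j})`. -/
def DotW12Vec.jac : DotW12Vec Ω →ₗ[ℝ] PiLp 2 (fun _ : Fin 3 × Fin 3 => L2 Ω) :=
  (WithLp.linearEquiv 2 ℝ (Fin 3 × Fin 3 → L2 Ω)).symm.toLinearMap.comp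
    (LinearMap.pi fun p => DotW12Vec.deriv p.1 p.2)

/- The (semi)norms `(∫ ψ_{,ij} ψ_{,ij})^{1/2}` and `(∫ w_{i,j} w_{i,j})^{1/2}`, with their inner
products. See `inner_dotW22` and `inner_dotW12Vec`. -/
instance : SeminormedAddCommGroup (DotW22 π) :=
  SeminormedAddCommGroup.induced (DotW22 π) _ DotW22.hess
instance : InnerProductSpace ℝ (DotW22 π) := InnerProductSpace.induced DotW22.hess
instance : SeminormedAddCommGroup (DotW12Vec Ω) :=
  SeminormedAddCommGroup.induced (DotW12Vec Ω) _ DotW12Vec.jac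
instance : InnerProductSpace ℝ (DotW12Vec Ω) := InnerProductSpace.induced DotW12Vec.jac

theorem inner_dotW22 (ψ ψ' : DotW22 π) :
    inner ℝ ψ ψ' = ∑ i, ∑ j, ∫ x in Ω.set, hessW i j ψ.incl x * hessW i j ψ'.incl x := by
  change inner ℝ (DotW22.hess ψ) (DotW22.hess ψ') = _
  rw [PiLp.inner_apply, Fintype.sum_prod_type]
  refine Finset.sum_congr rfl fun i _ => Finset.sum_congr rfl fun j _ => ?_
  rw [L2.inner_def]
  refine integral_congr_ae (Filter.Eventually.of_forall fun x => ?_)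
  exact mul_comm _ _

theorem inner_dotW12Vec (w w' : DotW12Vec Ω) :
    inner ℝ w w' = ∑ i, ∑ j, ∫ x in Ω.set, w.deriv i j x * w'.deriv i j x := by
  change inner ℝ (DotW12Vec.jac w) (DotW12Vec.jac w') = _
  rw [PiLp.inner_apply, Fintype.sum_prod_type]
  refine Finset.sum_congr rfl fun i _ => Finset.sum_congr rfl fun j _ => ?_
  rw [L2.inner_def]
  refine integral_congr_ae (Filter.Eventually.of_forall fun x => ?_)
  exact mul_comm _ _

end instances

/-! ### The mapping `∇̇` and its dual -/

theorem hasWeakDeriv_const (i : Fin 3) (c : ℝ) :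
    HasWeakDeriv i (Lp.const 2 Ω.vol c) 0 := by
  intro φ hφ hc hs
  have e1 : ∫ x in Ω.set, (Lp.const 2 Ω.vol c) x * fderiv ℝ φ x (EuclideanSpace.single i 1)
      = c * ∫ x in Ω.set, fderiv ℝ φ x (EuclideanSpace.single i 1) := by
    rw [← integral_const_mul]
    refine integral_congr_ae ?_
    filter_upwards [Lp.coeFn_const 2 Ω.vol c] with x hx
    rw [hx, Function.const_apply]
  have e2 : ∫ x in Ω.set, (0 : L2 Ω) x * φ x = 0 := by
    rw [← integral_zero E3 ℝ]
    refine integral_congr_ae ?_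
    filter_upwards [Lp.coeFn_zero ℝ 2 Ω.vol] with x hx
    rw [hx, Pi.zero_apply, zero_mul]
  have hz : ∀ x, x ∉ Ω.set → fderiv ℝ φ x (EuclideanSpace.single i 1) = 0 := by
    intro x hx
    have : x ∉ tsupport (fderiv ℝ φ) := fun h => hx (hs (tsupport_fderiv_subset ℝ h))
    rw [image_eq_zero_of_notMem_tsupport this]
    rfl
  have hint : Integrable (fun x => fderiv ℝ φ x (EuclideanSpace.single i 1)) volume :=
    ((hφ.continuous_fderiv (by simp)).clm_apply continuous_const).integrable_of_hasCompactSupport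
      (hc.fderiv_apply ℝ _)
  have e3 : ∫ x, fderiv ℝ φ x (EuclideanSpace.single i 1) = 0 := by
    have := integral_mul_fderiv_eq_neg_fderiv_mul_of_integrable (μ := (volume : Measure E3))
      (f := fun _ : E3 => (1 : ℝ)) (g := φ) (v := EuclideanSpace.single i 1)
      (by simp) (by simpa using hint)
      (by simpa using hφ.continuous.integrable_of_hasCompactSupport hc)
      (by simp) (fun x _ => hφ.differentiable (by simp) x)
    simpa using this
  rw [e1, e2, setIntegral_eq_integral_of_forall_compl_eq_zero hz, e3, mul_zero, neg_zero]

variable (Ω) in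
/-- Constant functions as elements of `W^{1,2}(Ω)`. -/
def constW : ℝ →ₗ[ℝ] W12 Ω :=
  (Lp.constₗ 2 Ω.vol ℝ).codRestrict (W12 Ω) fun c i => ⟨0, hasWeakDeriv_const i c⟩

theorem weakDeriv_constW (i : Fin 3) (c : ℝ) : weakDeriv i (constW Ω c) = 0 :=
  (hasWeakDeriv_weakDeriv i _).unique (hasWeakDeriv_const i c)

/-- The average `|Ω|⁻¹ ∫_Ω u`. -/
def average : W12 Ω →ₗ[ℝ] ℝ where
  toFun u := (volume.real Ω.set)⁻¹ * ∫ x in Ω.set, (u : L2 Ω) x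
  map_add' u v := by
    rw [Submodule.coe_add, integral_congr_ae (Lp.coeFn_add (u : L2 Ω) (v : L2 Ω))]
    simp only [Pi.add_apply]
    rw [integral_add ((Lp.memLp _).integrable (by norm_num))
      ((Lp.memLp _).integrable (by norm_num)), mul_add]
  map_smul' c u := by
    rw [Submodule.coe_smul, integral_congr_ae (Lp.coeFn_smul c (u : L2 Ω))]
    simp only [Pi.smul_apply]
    rw [integral_smul, RingHom.id_apply, smul_eq_mul, smul_eq_mul, mul_left_comm]

theorem volume_real_pos (Ω : LipschitzDomain) : 0 < volume.real Ω.set :=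
  ENNReal.toReal_pos (Ω.carrier.isOpen.measure_pos volume Ω.isConnected.nonempty).ne'
    Ω.isBounded.measure_lt_top.ne

theorem sub_average_mem (u : W12 Ω) : u - constW Ω (average u) ∈ meanZero Ω := by
  change ∫ x in Ω.set, ((u : L2 Ω) - Lp.const 2 Ω.vol (average u)) x = 0
  have e : ∫ x in Ω.set, ((u : L2 Ω) - Lp.const 2 Ω.vol (average u)) x
      = ∫ x in Ω.set, ((u : L2 Ω) x - average u) := by
    refine integral_congr_ae ?_
    filter_upwards [Lp.coeFn_sub (u : L2 Ω) (Lp.const 2 Ω.vol (average u)),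
      Lp.coeFn_const 2 Ω.vol (average u)] with x hx hx'
    rw [hx, Pi.sub_apply, hx', Function.const_apply]
  rw [e, integral_sub ((Lp.memLp _).integrable (by norm_num)) (integrable_const _),
    setIntegral_const, smul_eq_mul]
  change _ - volume.real Ω.set * ((volume.real Ω.set)⁻¹ * _) = 0
  rw [mul_inv_cancel_left₀ (volume_real_pos Ω).ne', sub_self]

/-- The projection `u ↦ u - |Ω|⁻¹ ∫_Ω u` of `W^{1,2}(Ω)` onto its mean-zero elements. -/
def subAverage : W12 Ω →ₗ[ℝ] meanZero Ω :=
  (LinearMap.id - (constW Ω).comp average).codRestrict (meanZero Ω) sub_average_mem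

theorem weakDeriv_subAverage (i : Fin 3) (u : W12 Ω) :
    weakDeriv i (subAverage u : W12 Ω) = weakDeriv i u := by
  change weakDeriv i (u - constW Ω (average u)) = _
  rw [map_sub, weakDeriv_constW, sub_zero]

variable {π : W22 Ω →ₗ[ℝ] W22 Ω}

variable (π) in
/-- The norm-preserving mapping `∇̇ : Ẇ^{2,2}(Ω) → Ẇ^{1,2}(Ω)³`, sending `ψ` to the mean-zero
representative of the class of `∇ψ`. -/
def gradDot : DotW22 π →ₗᵢ[ℝ] DotW12Vec Ω where
  toLinearMap := LinearMap.pi fun i => subAverage.comp ((gradW i).comp DotW22.incl)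
  norm_map' ψ := by
    change ‖DotW12Vec.jac (Ω := Ω) fun i => subAverage (gradW i ψ.incl)‖ = ‖DotW22.hess ψ‖
    congr 1
    ext1 p
    exact weakDeriv_subAverage p.2 (gradW p.1 ψ.incl)

variable (π) in
/-- The dual mapping `∇̇^* : Ẇ^{1,2}(Ω)^{3*} → Ẇ^{2,2}(Ω)^*`. -/
def gradStar (w : StrongDual ℝ (DotW12Vec Ω)) : StrongDual ℝ (DotW22 π) :=
  w.comp (gradDot π).toContinuousLinearMap

/-! ### Measures as functionals, and the mapping `δ` -/

instance {X : Type*} [MeasurableSpace X] (μ : SignedMeasure X) :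
    IsFiniteMeasure μ.variation := by
  rw [← SignedMeasure.totalVariation_eq_variation]
  infer_instance

/-- The bounded functional `g ↦ ∫ g dμ` on bounded continuous functions induced by a finite
signed Borel measure. -/
def measureFunctional {X : Type*} [TopologicalSpace X] [MeasurableSpace X] [BorelSpace X]
    (μ : SignedMeasure X) : StrongDual ℝ (X →ᵇ ℝ) :=
  LinearMap.mkContinuous
    { toFun := fun g => μ.integral (fun x => g x) (ContinuousLinearMap.lsmul ℝ ℝ)
      map_add' := fun f g => VectorMeasure.integral_fun_add
        (f.integrable μ.variation) (g.integrable μ.variation)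
      map_smul' := fun c g => VectorMeasure.integral_fun_smul _ _ c _ }
    (‖(ContinuousLinearMap.lsmul ℝ ℝ : ℝ →L[ℝ] ℝ →L[ℝ] ℝ)‖ * μ.variation.real Set.univ)
    (fun g => by
      have h := VectorMeasure.norm_integral_le_of_norm_le_const (μ := μ)
        (B := (ContinuousLinearMap.lsmul ℝ ℝ : ℝ →L[ℝ] ℝ →L[ℝ] ℝ)) (f := fun x => g x)
        (C := ‖g‖) (Filter.Eventually.of_forall g.norm_coe_le_norm)
      refine h.trans (le_of_eq ?_)
      ring)

/-- The type of the mapping `δ`, from potentials to pairs of continuous functions on `Ω` and on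
`∂Ω`. -/
abbrev EvalMap (π : W22 Ω →ₗ[ℝ] W22 Ω) : Type :=
  DotW22 π →L[ℝ] (Ω.set →ᵇ ℝ) × (frontier Ω.set →ᵇ ℝ)

/-- `δ ψ = (ψ, ψ|_{∂Ω})`, where `ψ` is identified with its representative that is continuous on
the closure of `Ω`. -/
def IsEvaluation (δ : EvalMap π) : Prop :=
  ∀ ψ : DotW22 π, ∃ g : E3 → ℝ, ContinuousOn g (closure Ω.set) ∧
    W22.toL2 ψ.incl =ᵐ[Ω.vol] g ∧
    (∀ x : Ω.set, (δ ψ).1 x = g x) ∧ (∀ x : frontier Ω.set, (δ ψ).2 x = g x)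

/-- The dual mapping `δ^*`. -/
def deltaStar (δ : EvalMap π)
    (F : StrongDual ℝ (Ω.set →ᵇ ℝ) × StrongDual ℝ (frontier Ω.set →ᵇ ℝ)) :
    StrongDual ℝ (DotW22 π) :=
  (F.1.coprod F.2).comp δ

/-- The pair of functionals `(β̂, τ̂)` induced by measures on `Ω` and `∂Ω`. -/
def hatPair (β : SignedMeasure Ω.set) (τ : SignedMeasure (frontier Ω.set)) :
    StrongDual ℝ (Ω.set →ᵇ ℝ) × StrongDual ℝ (frontier Ω.set →ᵇ ℝ) :=
  (measureFunctional β, measureFunctional τ)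

/-! ### The optimization problem -/

/-- The functional `φ ↦ ∫_Ω w_{i,j} φ_{i,j}` on `Ẇ^{1,2}(Ω)³` represented by the field `w`. -/
def fluxFunctional (w : DotW12Vec Ω) : StrongDual ℝ (DotW12Vec Ω) := innerSL ℝ w

/-- The weak balance equation `δ^*(β̂, τ̂) = ∇̇^*(w)`. -/
def WeakBalance (δ : EvalMap π) (β : SignedMeasure Ω.set) (τ : SignedMeasure (frontier Ω.set))
    (w : DotW12Vec Ω) : Prop :=
  deltaStar δ (hatPair β τ) = gradStar π (fluxFunctional w)

/-- The dissipation `∫_Ω w_{i,j} w_{i,j}`. -/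
def dissipation (w : DotW12Vec Ω) : ℝ := ∑ i, ∑ j, ∫ x in Ω.set, w.deriv i j x * w.deriv i j x

/-- `w` satisfies the weak balance equation and minimizes the dissipation among all solutions. -/
def IsOptimalFlux (δ : EvalMap π) (β : SignedMeasure Ω.set) (τ : SignedMeasure (frontier Ω.set))
    (w : DotW12Vec Ω) : Prop :=
  WeakBalance δ β τ w ∧ ∀ w', WeakBalance δ β τ w' → dissipation w ≤ dissipation w'

/-- The optimal value `ω_{(β,τ)}`: the infimum of `(∫_Ω w_{i,j} w_{i,j})^{1/2}` over all solutions
of the weak balance equation. -/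
def optimalValue (δ : EvalMap π) (β : SignedMeasure Ω.set) (τ : SignedMeasure (frontier Ω.set)) :
    ℝ :=
  sInf {r | ∃ w, WeakBalance δ β τ w ∧ r = √(dissipation w)}

end FluxOpt

end

open FluxOpt

open scoped ENNReal Convolution

noncomputable section

namespace FluxOpt

theorem norm_firstTwo_le (v : E3) : ‖(!₂[v 0, v 1] : EuclideanSpace ℝ (Fin 2))‖ ≤ ‖v‖ := by
  rw [EuclideanSpace.norm_eq, EuclideanSpace.norm_eq]
  refine Real.sqrt_le_sqrt ?_
  simp only [Fin.sum_univ_two, Fin.sum_univ_three]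
  have : 0 ≤ ‖v 2‖ ^ 2 := by positivity
  simpa using this

/-- Every point of the closure of a Lipschitz domain has a neighbourhood in which the domain is
star-shaped with respect to every point of some fixed ball. -/
theorem exists_star_nhds (Ω : LipschitzDomain) {x₀ : E3} (hx₀ : x₀ ∈ closure Ω.set) :
    ∃ ρ : ℝ, 0 < ρ ∧ ∃ b : E3, ∃ r : ℝ, 0 < r ∧ ∀ x ∈ Metric.ball x₀ ρ ∩ Ω.set,
      ∀ y ∈ Metric.closedBall b r, segment ℝ x y ⊆ Ω.set := by
  by_cases hx : x₀ ∈ Ω.set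
  · obtain ⟨ε, hε, hsub⟩ := Metric.isOpen_iff.1 Ω.carrier.isOpen x₀ hx
    refine ⟨ε, hε, x₀, ε / 2, by positivity, fun x hxx y hy => ?_⟩
    exact ((convex_ball x₀ ε).segment_subset hxx.1
      (Metric.closedBall_subset_ball (by linarith) hy)).trans hsub
  · have hfr : x₀ ∈ frontier Ω.set := by
      rw [Ω.carrier.isOpen.frontier_eq]; exact ⟨hx₀, hx⟩
    obtain ⟨r, hr, e, K, γ, hγ, hgraph⟩ := Ω.lipschitz x₀ hfr
    set t : ℝ := r / 2 with ht
    have hK : (0 : ℝ) ≤ K := K.2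
    set ρ : ℝ := t / (4 * (K + 1)) with hρ
    have htpos : 0 < t := by positivity
    have hρpos : 0 < ρ := by positivity
    have hρt : 4 * (K + 1) * ρ = t := by rw [hρ]; field_simp
    set b : E3 := x₀ + t • e.symm (EuclideanSpace.single 2 1) with hb
    refine ⟨ρ, hρpos, b, ρ, hρpos, fun x hxx y hy => ?_⟩
    have hxb := hxx.1
    have hρ4 : 4 * ρ ≤ t := by nlinarith
    have hyr : y ∈ Metric.ball x₀ r := by
      rw [Metric.mem_closedBall, dist_eq_norm] at hy
      rw [Metric.mem_ball, dist_eq_norm]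
      calc ‖y - x₀‖ = ‖(y - b) + t • e.symm (EuclideanSpace.single 2 1)‖ := by
            rw [hb]; congr 1; abel
        _ ≤ ‖y - b‖ + ‖t • e.symm (EuclideanSpace.single 2 (1 : ℝ))‖ := norm_add_le _ _
        _ ≤ ρ + t := by
            rw [norm_smul, e.symm.norm_map, PiLp.norm_single]
            simp only [Real.norm_eq_abs, abs_of_pos htpos, norm_one, mul_one]
            linarith
        _ < r := by linarith
    have hxr : x ∈ Metric.ball x₀ r := Metric.ball_subset_ball (by linarith) hxb
    set d : E3 := e (y - b) - e (x - x₀) with hd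
    have hdn : ‖d‖ ≤ 2 * ρ := by
      rw [Metric.mem_closedBall, dist_eq_norm] at hy
      rw [Metric.mem_ball, dist_eq_norm] at hxb
      calc ‖d‖ ≤ ‖e (y - b)‖ + ‖e (x - x₀)‖ := norm_sub_le _ _
        _ ≤ 2 * ρ := by rw [e.norm_map, e.norm_map]; linarith
    have hyx : e (y - x) = d + t • EuclideanSpace.single 2 1 := by
      have : y - x = (y - b) - (x - x₀) + t • e.symm (EuclideanSpace.single 2 1) := by
        rw [hb]; abel
      rw [this, map_add, map_sub, map_smul, e.apply_symm_apply]
    have h0 : e (y - x) 0 = d 0 := by rw [hyx]; simp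
    have h1 : e (y - x) 1 = d 1 := by rw [hyx]; simp
    have h2 : e (y - x) 2 = d 2 + t := by rw [hyx]; simp
    have hd2 : |d 2| ≤ 2 * ρ := (by simpa using PiLp.norm_apply_le d 2 : |d 2| ≤ ‖d‖).trans hdn
    have hslope : K * ‖(!₂[d 0, d 1] : EuclideanSpace ℝ (Fin 2))‖ ≤ d 2 + t := by
      have a1 : K * ‖(!₂[d 0, d 1] : EuclideanSpace ℝ (Fin 2))‖ ≤ K * (2 * ρ) :=
        mul_le_mul_of_nonneg_left ((norm_firstTwo_le d).trans hdn) hK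
      have a2 := (abs_le.1 hd2).1
      nlinarith
    rw [segment_eq_image']
    rintro _ ⟨s, ⟨hs0, hs1⟩, rfl⟩
    have hz : x + s • (y - x) ∈ Metric.ball x₀ r := by
      refine (convex_ball x₀ r).segment_subset hxr hyr ?_
      rw [segment_eq_image']; exact ⟨s, ⟨hs0, hs1⟩, rfl⟩
    change x + s • (y - x) ∈ Ω.set
    rw [hgraph _ hz]
    have hxg := (hgraph x hxr).1 hxx.2
    have hlip := hγ.dist_le_mul !₂[e (x + s • (y - x)) 0, e (x + s • (y - x)) 1] !₂[e x 0, e x 1]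
    have hdiff : (!₂[e (x + s • (y - x)) 0, e (x + s • (y - x)) 1] -
        !₂[e x 0, e x 1] : EuclideanSpace ℝ (Fin 2)) = s • !₂[d 0, d 1] := by
      rw [map_add, map_smul, ← h0, ← h1]
      ext j
      fin_cases j <;> simp
    rw [dist_eq_norm !₂[e (x + s • (y - x)) 0, e (x + s • (y - x)) 1] !₂[e x 0, e x 1],
      hdiff, norm_smul, Real.dist_eq,
      Real.norm_eq_abs, abs_of_nonneg hs0] at hlip
    have h3 : e (x + s • (y - x)) 2 = e x 2 + s * (d 2 + t) := by
      rw [map_add, map_smul, ← h2]; simp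
    rw [h3]
    have := (abs_le.1 hlip).2
    have := mul_le_mul_of_nonneg_left hslope hs0
    linarith

theorem sq_lintegral_mul_le {α : Type*} [MeasurableSpace α] (μ : Measure α) {f g : α → ℝ≥0∞}
    (hf : AEMeasurable f μ) (hg : AEMeasurable g μ) :
    (∫⁻ a, f a * g a ∂μ) ^ 2 ≤ (∫⁻ a, f a ^ 2 ∂μ) * ∫⁻ a, g a ^ 2 ∂μ := by
  have h := ENNReal.lintegral_mul_le_Lp_mul_Lq μ Real.HolderConjugate.two_two hf hg
  simp only [ENNReal.rpow_two, Pi.mul_apply] at h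
  calc _ ≤ ((∫⁻ a, f a ^ 2 ∂μ) ^ (1 / 2 : ℝ) * (∫⁻ a, g a ^ 2 ∂μ) ^ (1 / 2 : ℝ)) ^ 2 := by gcongr
    _ = _ := by
      rw [mul_pow, ← ENNReal.rpow_two, ← ENNReal.rpow_two, ← ENNReal.rpow_mul, ← ENNReal.rpow_mul]
      norm_num

theorem sq_lintegral_le {α : Type*} [MeasurableSpace α] (μ : Measure α) {f : α → ℝ≥0∞}
    (hf : AEMeasurable f μ) : (∫⁻ a, f a ∂μ) ^ 2 ≤ μ Set.univ * ∫⁻ a, f a ^ 2 ∂μ := by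
  have h := sq_lintegral_mul_le μ (f := fun _ => 1) aemeasurable_const hf
  simpa using h

/-- The square of the `L²` norm of a function on `ℝ³`. -/
def sqNorm (f : E3 → ℝ) : ℝ≥0∞ := ∫⁻ x, ‖f x‖ₑ ^ 2

theorem eLpNorm_two_sq (f : E3 → ℝ) : eLpNorm f 2 volume ^ 2 = sqNorm f := by
  rw [eLpNorm_eq_lintegral_rpow_enorm_toReal (by norm_num) (by norm_num), ← ENNReal.rpow_two,
    ← ENNReal.rpow_mul]
  simp [sqNorm]

theorem tendsto_sqNorm_translate {f : E3 → ℝ} (hf : MemLp f 2 volume) :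
    Filter.Tendsto (fun t : E3 => sqNorm fun x => f (x - t) - f x) (𝓝 0) (𝓝 0) := by
  let g : C(E3, C(E3, E3)) :=
    (ContinuousMap.mk (fun a : E3 × E3 => a.2 - a.1) (by fun_prop)).curry
  have hmp : ∀ t : E3, MeasurePreserving (g t) volume volume :=
    fun t => measurePreserving_sub_right volume t
  have hcont : Continuous fun t : E3 =>
      Lp.compMeasurePreserving (g t) (hmp t) (hf.toLp f) :=
    continuous_const.compMeasurePreservingLp g.continuous hmp (by norm_num)
  have h1 : Filter.Tendsto (fun t : E3 => edist (Lp.compMeasurePreserving (g t) (hmp t) (hf.toLp f))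
      (hf.toLp f)) (𝓝 0) (𝓝 0) := by
    have := (hcont.edist (continuous_const (y := hf.toLp f))).tendsto 0
    have e0 : Lp.compMeasurePreserving (g 0) (hmp 0) (hf.toLp f) = hf.toLp f := by
      rw [Lp.toLp_compMeasurePreserving]
      congr 1
      ext x
      simp [g]
    rwa [e0, edist_self] at this
  have h2 : (fun t : E3 => sqNorm fun x => f (x - t) - f x) = fun t =>
      (edist (Lp.compMeasurePreserving (g t) (hmp t) (hf.toLp f)) (hf.toLp f)) ^ 2 := by
    ext t
    rw [Lp.toLp_compMeasurePreserving, Lp.edist_toLp_toLp, eLpNorm_two_sq]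
    rfl
  rw [h2]
  simpa using ENNReal.Tendsto.pow (n := 2) h1

/-- A bump function supported in the ball of radius `1 / (n + 1)`. -/
def bump (n : ℕ) : ContDiffBump (0 : E3) where
  rIn := 1 / (2 * (n + 1))
  rOut := 1 / (n + 1)
  rIn_pos := by positivity
  rIn_lt_rOut := by
    apply one_div_lt_one_div_of_lt <;> linarith [(by positivity : (0 : ℝ) < n + 1)]

/-- Mollification of a function on `ℝ³`. -/
def mollify (n : ℕ) (f : E3 → ℝ) : E3 → ℝ :=
  f ⋆[ContinuousLinearMap.mul ℝ ℝ, volume] (bump n).normed volume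

theorem mollify_apply (n : ℕ) (f : E3 → ℝ) (x : E3) :
    mollify n f x = ∫ z, f z * (bump n).normed volume (x - z) := rfl

theorem mollify_apply' (n : ℕ) (f : E3 → ℝ) (x : E3) :
    mollify n f x = ∫ t, (bump n).normed volume t * f (x - t) := by
  rw [mollify_apply, ← integral_sub_left_eq_self _ volume x]
  simp [mul_comm]

theorem continuous_mollify (n : ℕ) {f : E3 → ℝ} (hf : LocallyIntegrable f volume) :
    Continuous (mollify n f) :=
  ((bump n).hasCompactSupport_normed).continuous_convolution_right _ hf
    (bump n).continuous_normed

theorem mollify_sub (n : ℕ) {f : E3 → ℝ} (hf : LocallyIntegrable f volume) (x : E3) :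
    mollify n f x - f x = ∫ t, (bump n).normed volume t * (f (x - t) - f x) := by
  have hi : Integrable (fun t => (bump n).normed volume t * f (x - t)) volume := by
    have := (((bump n).hasCompactSupport_normed (μ := (volume : Measure E3))).convolutionExists_right
      (ContinuousLinearMap.mul ℝ ℝ) hf (bump n).continuous_normed x)
    have h2 := this.integrable.comp_sub_left x
    refine h2.congr (Filter.Eventually.of_forall fun t => ?_)
    simp [mul_comm]
  simp only [mul_sub]
  rw [integral_sub hi ((bump n).integrable_normed.mul_const _), integral_mul_const,
    (bump n).integral_normed, one_mul, mollify_apply']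

theorem sqNorm_mollify_sub_le (n : ℕ) {f : E3 → ℝ} (hm : Measurable f)
    (hf : LocallyIntegrable f volume) :
    sqNorm (fun x => mollify n f x - f x) ≤
      ∫⁻ t, ENNReal.ofReal ((bump n).normed volume t) * sqNorm fun x => f (x - t) - f x := by
  have hρm : Measurable fun t => ENNReal.ofReal ((bump n).normed volume t) :=
    (bump n).continuous_normed.measurable.ennreal_ofReal
  have hρ1 : ∫⁻ t, ENNReal.ofReal ((bump n).normed volume t) = 1 := by
    rw [← ofReal_integral_eq_lintegral_ofReal (bump n).integrable_normed
      (Filter.Eventually.of_forall (bump n).nonneg_normed), (bump n).integral_normed]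
    simp
  set ν : Measure E3 := volume.withDensity fun t => ENNReal.ofReal ((bump n).normed volume t)
  have hν : ν Set.univ = 1 := by
    rw [withDensity_apply _ MeasurableSet.univ, Measure.restrict_univ, hρ1]
  have hpt : ∀ x, ‖mollify n f x - f x‖ₑ ^ 2 ≤
      ∫⁻ t, ENNReal.ofReal ((bump n).normed volume t) * ‖f (x - t) - f x‖ₑ ^ 2 := by
    intro x
    have hmx : Measurable fun t => ‖f (x - t) - f x‖ₑ :=
      ((hm.comp (measurable_const.sub measurable_id)).sub_const _).enorm
    have h1 : ‖mollify n f x - f x‖ₑ ≤ ∫⁻ t, ‖f (x - t) - f x‖ₑ ∂ν := by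
      rw [mollify_sub n hf, lintegral_withDensity_eq_lintegral_mul _ hρm hmx]
      refine (enorm_integral_le_lintegral_enorm _).trans (le_of_eq ?_)
      refine lintegral_congr fun t => ?_
      rw [enorm_mul, Real.enorm_of_nonneg ((bump n).nonneg_normed t)]
      rfl
    calc _ ≤ (∫⁻ t, ‖f (x - t) - f x‖ₑ ∂ν) ^ 2 := by gcongr
      _ ≤ ν Set.univ * ∫⁻ t, ‖f (x - t) - f x‖ₑ ^ 2 ∂ν := sq_lintegral_le ν hmx.aemeasurable
      _ = _ := by
        rw [hν, one_mul, lintegral_withDensity_eq_lintegral_mul _ hρm (hmx.pow_const 2)]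
        rfl
  calc _ ≤ ∫⁻ x, ∫⁻ t, ENNReal.ofReal ((bump n).normed volume t) * ‖f (x - t) - f x‖ₑ ^ 2 :=
        lintegral_mono hpt
    _ = ∫⁻ t, ∫⁻ x, ENNReal.ofReal ((bump n).normed volume t) * ‖f (x - t) - f x‖ₑ ^ 2 := by
        refine lintegral_lintegral_swap (Measurable.aemeasurable ?_)
        exact (hρm.comp measurable_snd).mul
          (((hm.comp (measurable_fst.sub measurable_snd)).sub
            (hm.comp measurable_fst)).enorm.pow_const 2)
    _ = _ := by
        refine lintegral_congr fun t => ?_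
        rw [lintegral_const_mul' _ _ ENNReal.ofReal_ne_top]
        rfl

theorem tendsto_sqNorm_mollify {f : E3 → ℝ} (hm : Measurable f) (hf : MemLp f 2 volume) :
    Filter.Tendsto (fun n => sqNorm fun x => mollify n f x - f x) Filter.atTop (𝓝 0) := by
  rw [ENNReal.tendsto_nhds_zero]
  intro ε hε
  obtain ⟨δ, hδ, hball⟩ := Metric.eventually_nhds_iff.1
    ((ENNReal.tendsto_nhds_zero.1 (tendsto_sqNorm_translate hf)) ε hε)
  obtain ⟨N, hN⟩ := exists_nat_one_div_lt hδ
  filter_upwards [Filter.eventually_ge_atTop N] with n hn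
  refine (sqNorm_mollify_sub_le n hm (hf.locallyIntegrable (by norm_num))).trans ?_
  have hρ1 : ∫⁻ t, ENNReal.ofReal ((bump n).normed volume t) = 1 := by
    rw [← ofReal_integral_eq_lintegral_ofReal (bump n).integrable_normed
      (Filter.Eventually.of_forall (bump n).nonneg_normed), (bump n).integral_normed]
    simp
  calc _ ≤ ∫⁻ t, ENNReal.ofReal ((bump n).normed volume t) * ε := by
        refine lintegral_mono fun t => ?_
        by_cases ht : t ∈ Metric.ball (0 : E3) (bump n).rOut
        · have : dist t 0 < δ := by
            have h1 : dist t 0 < 1 / (n + 1) := ht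
            have h2 : (1 : ℝ) / (n + 1) ≤ 1 / (N + 1) := by
              apply one_div_le_one_div_of_le (by positivity)
              have : (N : ℝ) ≤ n := by exact_mod_cast hn
              linarith
            linarith
          gcongr
          exact hball this
        · rw [← (bump n).support_normed_eq (μ := volume), Function.notMem_support] at ht
          simp [ht]
    _ = ε := by rw [lintegral_mul_const _ (bump n).continuous_normed.measurable.ennreal_ofReal, hρ1,
          one_mul]

/-- Extension by zero of a function on `Ω`. -/
def extend {Ω : LipschitzDomain} (u : L2 Ω) : E3 → ℝ := Ω.set.indicator u

variable {Ω : LipschitzDomain}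

theorem measurable_extend (u : L2 Ω) : Measurable (extend u) :=
  (Lp.stronglyMeasurable u).measurable.indicator Ω.carrier.isOpen.measurableSet

theorem memLp_extend (u : L2 Ω) : MemLp (extend u) 2 volume :=
  (memLp_indicator_iff_restrict Ω.carrier.isOpen.measurableSet).2 (Lp.memLp u)

theorem locallyIntegrable_extend (u : L2 Ω) : LocallyIntegrable (extend u) volume :=
  (memLp_extend u).locallyIntegrable (by norm_num)

theorem sqNorm_extend (u : L2 Ω) : sqNorm (extend u) = ‖u‖ₑ ^ 2 := by
  rw [← eLpNorm_two_sq, extend, eLpNorm_indicator_eq_eLpNorm_restrict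
    Ω.carrier.isOpen.measurableSet, Lp.enorm_def]

theorem integral_extend_mul (u : L2 Ω) (g : E3 → ℝ) :
    ∫ z, extend u z * g z = ∫ z in Ω.set, u z * g z := by
  rw [← integral_indicator Ω.carrier.isOpen.measurableSet]
  refine integral_congr_ae (Filter.Eventually.of_forall fun z => ?_)
  by_cases hz : z ∈ Ω.set <;> simp [extend, hz]

theorem hasFDerivAt_mollify {u : L2 Ω} {v : Fin 3 → L2 Ω} (h : ∀ i, HasWeakDeriv i u (v i))
    {n : ℕ} {x : E3} (hx : Metric.closedBall x (1 / (n + 1)) ⊆ Ω.set) :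
    HasFDerivAt (mollify n (extend u))
      (∑ i, mollify n (extend (v i)) x • (EuclideanSpace.proj i : E3 →L[ℝ] ℝ)) x := by
  have hρ : ContDiff ℝ 1 ((bump n).normed (volume : Measure E3)) := (bump n).contDiff_normed
  have hc := (bump n).hasCompactSupport_normed (μ := (volume : Measure E3))
  have hd := hc.hasFDerivAt_convolution_right (ContinuousLinearMap.mul ℝ ℝ)
    (locallyIntegrable_extend u) hρ x
  refine hd.congr_fderiv ?_
  have key : ∀ i, ((extend u ⋆[(ContinuousLinearMap.mul ℝ ℝ).precompR E3, volume]
      fderiv ℝ ((bump n).normed (volume : Measure E3))) x) (EuclideanSpace.single i 1)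
      = mollify n (extend (v i)) x := by
    intro i
    rw [convolution_precompR_apply _ (locallyIntegrable_extend u) (hc.fderiv ℝ)
      (hρ.continuous_fderiv one_ne_zero)]
    have hψ : ContDiff ℝ ∞ fun z : E3 => (bump n).normed (volume : Measure E3) (x - z) :=
      (bump n).contDiff_normed.comp (contDiff_const.sub contDiff_id)
    have hψd : ∀ z, fderiv ℝ (fun z : E3 => (bump n).normed (volume : Measure E3) (x - z)) z
        = -fderiv ℝ ((bump n).normed (volume : Measure E3)) (x - z) := by
      intro z
      have h1 := ((hρ.differentiable one_ne_zero).differentiableAt (x := x - z)).hasFDerivAt.comp z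
        ((hasFDerivAt_const x z).sub (hasFDerivAt_id z))
      refine (HasFDerivAt.fderiv h1).trans ?_
      ext w
      simp
    have hψs : tsupport (fun z : E3 => (bump n).normed (volume : Measure E3) (x - z))
        ⊆ Metric.closedBall x (1 / (n + 1)) := by
      refine closure_minimal (fun z hz => ?_) Metric.isClosed_closedBall
      have : x - z ∈ Function.support ((bump n).normed (volume : Measure E3)) := hz
      rw [(bump n).support_normed_eq, mem_ball_zero_iff] at this
      rw [mem_closedBall_iff_norm']
      exact this.le
    have hψc : HasCompactSupport fun z : E3 => (bump n).normed (volume : Measure E3) (x - z) :=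
      (isCompact_closedBall x _).of_isClosed_subset (isClosed_tsupport _) hψs
    have := h i _ hψ hψc (hψs.trans hx)
    simp only [hψd, neg_apply, mul_neg, integral_neg, neg_inj] at this
    rw [mollify_apply, integral_extend_mul, ← this, ← integral_extend_mul]
    rfl
  refine ContinuousLinearMap.ext fun w => ?_
  have hw : w = ∑ i, w i • (EuclideanSpace.single i 1 : E3) := by
    ext j
    simp [Pi.single_apply]
  conv_lhs => rw [hw]
  rw [map_sum, sum_apply]
  refine Finset.sum_congr rfl fun i _ => ?_
  rw [map_smul, key]
  simp [mul_comm]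

theorem lintegral_comp_smul_add {c : ℝ} (hc : 0 < c) (a : E3) {F : E3 → ℝ≥0∞} (hF : Measurable F) :
    ∫⁻ x, F (c • x + a) = ENNReal.ofReal ((c ^ 3)⁻¹) * ∫⁻ x, F x := by
  have h1 : ∫⁻ x, F (c • x + a) = ∫⁻ z, F (z + a) ∂(Measure.map (c • ·) (volume : Measure E3)) :=
    (lintegral_map (hF.comp (measurable_id.add_const a)) (measurable_const_smul c)).symm
  rw [h1, Measure.map_addHaar_smul volume hc.ne', lintegral_smul_measure,
    lintegral_add_right_eq_self, finrank_euclideanSpace_fin, abs_of_pos (by positivity)]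
  rfl

theorem lintegral_segment_right_le {s : ℝ} (hs : 1 / 2 ≤ s) (x : E3) {F : E3 → ℝ≥0∞}
    (hF : Measurable F) : ∫⁻ y, F (x + s • (y - x)) ≤ 8 * ∫⁻ x, F x := by
  have : ∀ y, x + s • (y - x) = s • y + (x - s • x) := fun y => by rw [smul_sub]; abel
  simp only [this]
  rw [lintegral_comp_smul_add (by linarith) _ hF]
  gcongr
  rw [show (8 : ℝ≥0∞) = ENNReal.ofReal 8 by norm_num]
  refine ENNReal.ofReal_le_ofReal ?_
  rw [show (8 : ℝ) = ((1 / 2 : ℝ) ^ 3)⁻¹ by norm_num]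
  gcongr

theorem lintegral_segment_left_le {s : ℝ} (hs : s ≤ 1 / 2) (y : E3) {F : E3 → ℝ≥0∞}
    (hF : Measurable F) : ∫⁻ x, F (x + s • (y - x)) ≤ 8 * ∫⁻ x, F x := by
  have : ∀ x, x + s • (y - x) = y + (1 - s) • (x - y) := fun x => by
    rw [sub_smul, one_smul, smul_sub, smul_sub]; abel
  simp only [this]
  exact lintegral_segment_right_le (by linarith) y hF

theorem hasDerivAt_comp_segment {v : E3 → ℝ} {w : Fin 3 → E3 → ℝ} {x y : E3} {s : ℝ}
    (h : HasFDerivAt v (∑ i, w i (x + s • (y - x)) • (EuclideanSpace.proj i : E3 →L[ℝ] ℝ))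
      (x + s • (y - x))) :
    HasDerivAt (fun s : ℝ => v (x + s • (y - x)))
      (∑ i, w i (x + s • (y - x)) * (y - x) i) s := by
  have h1 : HasDerivAt (fun s : ℝ => x + s • (y - x)) (y - x) s := by
    simpa using ((hasDerivAt_id s).smul_const (y - x)).const_add x
  have := h.comp_hasDerivAt s h1
  simpa [sum_apply, Function.comp_def] using! this

theorem enorm_sub_le_lintegral_segment {v : E3 → ℝ} {w : Fin 3 → E3 → ℝ}
    (hw : ∀ i, Continuous (w i)) {x y : E3} {D : NNReal} (hD : ‖y - x‖ ≤ D)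
    (h : ∀ z ∈ segment ℝ x y,
      HasFDerivAt v (∑ i, w i z • (EuclideanSpace.proj i : E3 →L[ℝ] ℝ)) z) :
    ‖v x - v y‖ₑ ≤ ∫⁻ s in Set.Ioc (0 : ℝ) 1, D * ∑ i, ‖w i (x + s • (y - x))‖ₑ := by
  have hcont : Continuous fun s : ℝ => ∑ i, w i (x + s • (y - x)) * (y - x) i := by fun_prop
  have hFTC := intervalIntegral.integral_eq_sub_of_hasDerivAt (a := 0) (b := 1)
    (f := fun s : ℝ => v (x + s • (y - x)))
    (f' := fun s => ∑ i, w i (x + s • (y - x)) * (y - x) i) (fun s hs => by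
      refine hasDerivAt_comp_segment (h _ ?_)
      rw [segment_eq_image']
      rw [Set.uIcc_of_le zero_le_one] at hs
      exact ⟨s, hs, rfl⟩) (hcont.intervalIntegrable _ _)
  rw [intervalIntegral.integral_of_le zero_le_one] at hFTC
  have e : v x - v y = -∫ s in Set.Ioc (0 : ℝ) 1, ∑ i, w i (x + s • (y - x)) * (y - x) i := by
    rw [hFTC]; simp
  rw [e, enorm_neg]
  refine (enorm_integral_le_lintegral_enorm _).trans (lintegral_mono fun s => ?_)
  refine (enorm_sum_le _ _).trans ?_
  rw [Finset.mul_sum]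
  refine Finset.sum_le_sum fun i _ => ?_
  rw [enorm_mul, mul_comm]
  gcongr
  rw [← ofReal_norm, ← ENNReal.ofReal_coe_nnreal]
  exact ENNReal.ofReal_le_ofReal ((PiLp.norm_apply_le (y - x) i).trans hD)

theorem lintegral_segments_le {K B : Set E3} {F : E3 → ℝ≥0∞} (hF : Measurable F) :
    ∫⁻ x in K, ∫⁻ y in B, ∫⁻ s in Set.Ioc (0 : ℝ) 1, F (x + s • (y - x)) ≤
      (8 * (volume K + volume B)) * ∫⁻ z, F z := by
  have hm : Measurable fun p : ℝ × E3 × E3 => F (p.2.1 + p.1 • (p.2.2 - p.2.1)) :=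
    hF.comp (by fun_prop)
  have e1 : ∀ x, ∫⁻ y in B, ∫⁻ s in Set.Ioc (0 : ℝ) 1, F (x + s • (y - x)) =
      ∫⁻ s in Set.Ioc (0 : ℝ) 1, ∫⁻ y in B, F (x + s • (y - x)) := fun x =>
    lintegral_lintegral_swap (hm.comp (f := fun q : E3 × ℝ => (q.2, x, q.1))
      (by fun_prop)).aemeasurable
  have e2 : ∫⁻ x in K, ∫⁻ s in Set.Ioc (0 : ℝ) 1, ∫⁻ y in B, F (x + s • (y - x)) =
      ∫⁻ s in Set.Ioc (0 : ℝ) 1, ∫⁻ x in K, ∫⁻ y in B, F (x + s • (y - x)) := by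
    refine lintegral_lintegral_swap (Measurable.aemeasurable ?_)
    exact Measurable.lintegral_prod_right' (f := fun q : (E3 × ℝ) × E3 =>
      F (q.1.1 + q.1.2 • (q.2 - q.1.1))) (hm.comp (f := fun q : (E3 × ℝ) × E3 =>
        (q.1.2, q.1.1, q.2)) (by fun_prop))
  simp only [e1]
  rw [e2]
  have key : ∀ s : ℝ, ∫⁻ x in K, ∫⁻ y in B, F (x + s • (y - x)) ≤
      (8 * (volume K + volume B)) * ∫⁻ z, F z := by
    intro s
    rcases le_total (1 / 2) s with hs | hs
    · calc _ ≤ ∫⁻ _ in K, 8 * ∫⁻ z, F z := lintegral_mono fun x =>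
            (setLIntegral_le_lintegral _ _).trans (lintegral_segment_right_le hs x hF)
        _ = (8 * volume K) * ∫⁻ z, F z := by rw [setLIntegral_const]; ring
        _ ≤ _ := by gcongr; exact le_self_add
    · have hsw : ∫⁻ x in K, ∫⁻ y in B, F (x + s • (y - x)) =
          ∫⁻ y in B, ∫⁻ x in K, F (x + s • (y - x)) :=
        lintegral_lintegral_swap (hm.comp (f := fun q : E3 × E3 => (s, q.1, q.2))
          (by fun_prop)).aemeasurable
      rw [hsw]
      calc _ ≤ ∫⁻ _ in B, 8 * ∫⁻ z, F z := lintegral_mono fun y =>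
            (setLIntegral_le_lintegral _ _).trans (lintegral_segment_left_le hs y hF)
        _ = (8 * volume B) * ∫⁻ z, F z := by rw [setLIntegral_const]; ring
        _ ≤ _ := by gcongr; exact le_add_self
  calc _ ≤ ∫⁻ _ in Set.Ioc (0 : ℝ) 1, (8 * (volume K + volume B)) * ∫⁻ z, F z :=
        lintegral_mono key
    _ = _ := by simp

theorem sq_sum_three_le (a : Fin 3 → ℝ≥0∞) : (∑ i, a i) ^ 2 ≤ 3 * ∑ i, a i ^ 2 := by
  by_cases h : ∃ i, a i = ⊤
  · obtain ⟨i, hi⟩ := h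
    have : ∑ i, a i ^ 2 = ⊤ := ENNReal.sum_eq_top.2 ⟨i, Finset.mem_univ _, by simp [hi]⟩
    simp [this]
  · push Not at h
    lift a to Fin 3 → NNReal using h
    have := sq_sum_le_card_mul_sum_sq (s := Finset.univ) (f := fun i => (a i : ℝ))
    simp only [Finset.card_univ, Fintype.card_fin] at this
    change (∑ i, (a i : ℝ≥0∞)) ^ 2 ≤ 3 * ∑ i, (a i : ℝ≥0∞) ^ 2
    exact_mod_cast this

theorem lintegral_sq_sub_le {K B : Set E3} (hK : MeasurableSet K) (hB : MeasurableSet B)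
    {D : NNReal} (hD : ∀ x ∈ K, ∀ y ∈ B, ‖y - x‖ ≤ D)
    {v : E3 → ℝ} {w : Fin 3 → E3 → ℝ} (hw : ∀ i, Continuous (w i))
    (h : ∀ x ∈ K, ∀ y ∈ B, ∀ z ∈ segment ℝ x y,
      HasFDerivAt v (∑ i, w i z • (EuclideanSpace.proj i : E3 →L[ℝ] ℝ)) z) :
    ∫⁻ x in K, ∫⁻ y in B, ‖v x - v y‖ₑ ^ 2 ≤
      (D ^ 2 * 3 * (8 * (volume K + volume B))) * ∑ i, sqNorm (w i) := by
  have hpt : ∀ x ∈ K, ∀ y ∈ B, ‖v x - v y‖ₑ ^ 2 ≤ (D ^ 2 * 3) *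
      ∫⁻ s in Set.Ioc (0 : ℝ) 1, ∑ i, ‖w i (x + s • (y - x))‖ₑ ^ 2 := by
    intro x hx y hy
    have hm : Measurable fun s : ℝ => D * ∑ i, ‖w i (x + s • (y - x))‖ₑ := by
      refine Measurable.const_mul (Finset.measurable_fun_sum _ fun i _ => ?_) _
      exact ((hw i).comp (by fun_prop)).measurable.enorm
    calc _ ≤ (∫⁻ s in Set.Ioc (0 : ℝ) 1, D * ∑ i, ‖w i (x + s • (y - x))‖ₑ) ^ 2 := by
          gcongr
          exact enorm_sub_le_lintegral_segment hw (hD x hx y hy) (h x hx y hy)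
      _ ≤ ∫⁻ s in Set.Ioc (0 : ℝ) 1, (D * ∑ i, ‖w i (x + s • (y - x))‖ₑ) ^ 2 := by
          refine (sq_lintegral_le _ hm.aemeasurable).trans (le_of_eq ?_)
          simp
      _ ≤ ∫⁻ s in Set.Ioc (0 : ℝ) 1, (D ^ 2 * 3) * ∑ i, ‖w i (x + s • (y - x))‖ₑ ^ 2 := by
          refine lintegral_mono fun s => ?_
          rw [mul_pow, mul_assoc]
          gcongr
          exact sq_sum_three_le _
      _ = _ := lintegral_const_mul' _ _ (by finiteness)
  have hF : Measurable fun z => ∑ i, ‖w i z‖ₑ ^ 2 :=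
    Finset.measurable_fun_sum _ fun i _ => (hw i).measurable.enorm.pow_const 2
  calc _ ≤ ∫⁻ x in K, ∫⁻ y in B, (D ^ 2 * 3) *
        ∫⁻ s in Set.Ioc (0 : ℝ) 1, ∑ i, ‖w i (x + s • (y - x))‖ₑ ^ 2 :=
      setLIntegral_mono' hK fun x hx => setLIntegral_mono' hB fun y hy => hpt x hx y hy
    _ = (D ^ 2 * 3) * ∫⁻ x in K, ∫⁻ y in B,
        ∫⁻ s in Set.Ioc (0 : ℝ) 1, ∑ i, ‖w i (x + s • (y - x))‖ₑ ^ 2 := by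
      rw [← lintegral_const_mul' _ _ (by finiteness)]
      refine lintegral_congr fun x => ?_
      rw [← lintegral_const_mul' _ _ (by finiteness)]
    _ ≤ (D ^ 2 * 3) * ((8 * (volume K + volume B)) * ∫⁻ z, ∑ i, ‖w i z‖ₑ ^ 2) := by
      gcongr
      exact lintegral_segments_le hF
    _ = _ := by
      rw [lintegral_finsetSum _ fun i _ => (hw i).measurable.enorm.pow_const 2]
      simp only [sqNorm]
      ring

theorem ae_tendsto_mollify {f : E3 → ℝ} (hf : LocallyIntegrable f volume) :
    ∀ᵐ x, Filter.Tendsto (fun n => mollify n f x) Filter.atTop (𝓝 (f x)) := by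
  have h := ContDiffBump.ae_convolution_tendsto_right_of_locallyIntegrable (φ := bump)
    (l := Filter.atTop) (K := 2) (g := f) (μ := (volume : Measure E3))
    tendsto_one_div_add_atTop_nhds_zero_nat
    (Filter.Eventually.of_forall fun n => by
      change (1 : ℝ) / (n + 1) ≤ 2 * (1 / (2 * (n + 1)))
      refine le_of_eq ?_
      field_simp) hf
  filter_upwards [h] with x hx
  refine hx.congr fun n => ?_
  rw [mollify_apply']
  rfl

theorem ennreal_add_sq_le (a b : ℝ≥0∞) : (a + b) ^ 2 ≤ 2 * (a ^ 2 + b ^ 2) := by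
  by_cases ha : a = ⊤
  · simp [ha]
  by_cases hb : b = ⊤
  · simp [hb]
  lift a to NNReal using ha
  lift b to NNReal using hb
  exact_mod_cast add_sq_le (a := a) (b := b)

theorem sqNorm_le_two_mul (f g : E3 → ℝ) (hg : Measurable g) :
    sqNorm f ≤ 2 * sqNorm (fun x => f x - g x) + 2 * sqNorm g := by
  have hpt : ∀ x, ‖f x‖ₑ ^ 2 ≤ 2 * ‖f x - g x‖ₑ ^ 2 + 2 * ‖g x‖ₑ ^ 2 := by
    intro x
    have h1 : ‖f x‖ₑ ≤ ‖f x - g x‖ₑ + ‖g x‖ₑ := by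
      simpa using enorm_add_le (f x - g x) (g x)
    refine (pow_le_pow_left₀ zero_le h1 2).trans ?_
    have := ennreal_add_sq_le ‖f x - g x‖ₑ ‖g x‖ₑ
    rwa [mul_add] at this
  refine (lintegral_mono hpt).trans (le_of_eq ?_)
  rw [lintegral_add_right _ ((hg.enorm.pow_const 2).const_mul 2),
    lintegral_const_mul' _ _ (by finiteness), lintegral_const_mul' _ _ (by finiteness)]
  rfl

theorem eventually_closedBall_subset {K : Set E3} (hK : IsCompact K) (hKΩ : K ⊆ Ω.set) :
    ∀ᶠ n : ℕ in Filter.atTop, ∀ x ∈ K, Metric.closedBall x (1 / (n + 1)) ⊆ Ω.set := by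
  obtain ⟨δ, hδ, hsub⟩ := hK.exists_cthickening_subset_open Ω.carrier.isOpen hKΩ
  obtain ⟨N, hN⟩ := exists_nat_one_div_lt hδ
  filter_upwards [Filter.eventually_ge_atTop N] with n hn x hx
  have h2 : (1 : ℝ) / (n + 1) ≤ 1 / (N + 1) := by
    apply one_div_le_one_div_of_le (by positivity)
    have : (N : ℝ) ≤ n := by exact_mod_cast hn
    linarith
  exact ((Metric.closedBall_subset_closedBall (h2.trans hN.le)).trans
    (Metric.closedBall_subset_cthickening hx δ)).trans hsub

theorem isCompact_iUnion_segment {K B : Set E3} (hK : IsCompact K) (hB : IsCompact B) :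
    IsCompact {z | ∃ x ∈ K, ∃ y ∈ B, z ∈ segment ℝ x y} := by
  have := (hK.prod (hB.prod (isCompact_Icc (a := (0 : ℝ)) (b := 1)))).image
    (f := fun p : E3 × E3 × ℝ => p.1 + p.2.2 • (p.2.1 - p.1)) (by fun_prop)
  convert this using 1
  ext z
  simp only [segment_eq_image', Set.mem_ofPred_eq, Set.mem_image, Prod.exists, Set.mem_prod]
  constructor
  · rintro ⟨x, hx, y, hy, s, hs, rfl⟩
    exact ⟨x, y, s, ⟨hx, hy, hs⟩, rfl⟩
  · rintro ⟨x, y, s, ⟨hx, hy, hs⟩, rfl⟩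
    exact ⟨x, hx, y, hy, s, hs, rfl⟩

theorem lintegral_sq_sub_extend_le_of_isCompact {K B : Set E3} (hK : IsCompact K)
    (hB : IsCompact B) {D : NNReal} (hD : ∀ x ∈ K, ∀ y ∈ B, ‖y - x‖ ≤ D)
    (hseg : ∀ x ∈ K, ∀ y ∈ B, segment ℝ x y ⊆ Ω.set)
    {u : L2 Ω} {v : Fin 3 → L2 Ω} (h : ∀ i, HasWeakDeriv i u (v i)) :
    ∫⁻ x in K, ∫⁻ y in B, ‖extend u x - extend u y‖ₑ ^ 2 ≤
      (D ^ 2 * 3 * (8 * (volume K + volume B))) * (2 * ∑ i, ‖v i‖ₑ ^ 2) := by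
  set C : ℝ≥0∞ := D ^ 2 * 3 * (8 * (volume K + volume B)) with hC
  have hCtop : C ≠ ⊤ := by
    have := hK.measure_lt_top (μ := volume).ne
    have := hB.measure_lt_top (μ := volume).ne
    finiteness
  have hcm : ∀ n, Continuous (mollify n (extend u)) := fun n =>
    continuous_mollify n (locallyIntegrable_extend u)
  have hbound : ∀ᶠ n in Filter.atTop,
      ∫⁻ x in K, ∫⁻ y in B, ‖mollify n (extend u) x - mollify n (extend u) y‖ₑ ^ 2 ≤
      C * ∑ i, (2 * sqNorm (fun x => mollify n (extend (v i)) x - extend (v i) x)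
        + 2 * ‖v i‖ₑ ^ 2) := by
    have hsub : {z | ∃ x ∈ K, ∃ y ∈ B, z ∈ segment ℝ x y} ⊆ Ω.set := by
      rintro z ⟨x, hx, y, hy, hz⟩
      exact hseg x hx y hy hz
    filter_upwards [eventually_closedBall_subset (isCompact_iUnion_segment hK hB) hsub] with n hn
    refine (lintegral_sq_sub_le hK.measurableSet hB.measurableSet hD
      (w := fun i => mollify n (extend (v i)))
      (fun i => continuous_mollify n (locallyIntegrable_extend (v i)))
      fun x hx y hy z hz => hasFDerivAt_mollify h (hn z ⟨x, hx, y, hy, hz⟩)).trans ?_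
    gcongr with i
    rw [← sqNorm_extend]
    exact sqNorm_le_two_mul _ _ (measurable_extend _)
  have hlim : Filter.Tendsto (fun n => C * ∑ i,
      (2 * sqNorm (fun x => mollify n (extend (v i)) x - extend (v i) x) + 2 * ‖v i‖ₑ ^ 2))
      Filter.atTop (𝓝 (C * (2 * ∑ i, ‖v i‖ₑ ^ 2))) := by
    refine ENNReal.Tendsto.const_mul ?_ (Or.inr hCtop)
    rw [Finset.mul_sum]
    refine tendsto_finsetSum _ fun i _ => ?_
    have := (ENNReal.Tendsto.const_mul (a := 2)
      (tendsto_sqNorm_mollify (measurable_extend (v i)) (memLp_extend (v i)))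
      (Or.inr (by finiteness))).add_const (2 * ‖v i‖ₑ ^ 2)
    simpa using this
  have hae := ae_tendsto_mollify (locallyIntegrable_extend u)
  have hconv : ∀ᵐ x ∂(volume.restrict K), ∀ᵐ y ∂(volume.restrict B),
      ‖extend u x - extend u y‖ₑ ^ 2 = Filter.liminf
        (fun n => ‖mollify n (extend u) x - mollify n (extend u) y‖ₑ ^ 2) Filter.atTop := by
    filter_upwards [ae_restrict_of_ae hae] with x hx
    filter_upwards [ae_restrict_of_ae hae] with y hy
    exact (ENNReal.Tendsto.pow (hx.sub hy).enorm).liminf_eq.symm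
  calc _ = ∫⁻ x in K, ∫⁻ y in B, Filter.liminf
        (fun n => ‖mollify n (extend u) x - mollify n (extend u) y‖ₑ ^ 2) Filter.atTop := by
        refine lintegral_congr_ae ?_
        filter_upwards [hconv] with x hx
        exact lintegral_congr_ae hx
    _ ≤ ∫⁻ x in K, Filter.liminf (fun n =>
        ∫⁻ y in B, ‖mollify n (extend u) x - mollify n (extend u) y‖ₑ ^ 2) Filter.atTop := by
        refine lintegral_mono fun x => lintegral_liminf_le fun n => ?_
        exact ((hcm n).measurable.const_sub _).enorm.pow_const 2
    _ ≤ Filter.liminf (fun n => ∫⁻ x in K,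
        ∫⁻ y in B, ‖mollify n (extend u) x - mollify n (extend u) y‖ₑ ^ 2) Filter.atTop := by
        refine lintegral_liminf_le fun n => ?_
        refine Measurable.lintegral_prod_right' (f := fun p : E3 × E3 =>
          ‖mollify n (extend u) p.1 - mollify n (extend u) p.2‖ₑ ^ 2) ?_
        have := hcm n
        exact (Continuous.measurable (by fun_prop)).enorm.pow_const 2
    _ ≤ Filter.liminf (fun n => C * ∑ i,
        (2 * sqNorm (fun x => mollify n (extend (v i)) x - extend (v i) x) + 2 * ‖v i‖ₑ ^ 2))
        Filter.atTop := Filter.liminf_le_liminf hbound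
    _ = _ := hlim.liminf_eq

theorem lintegral_sq_sub_extend_le {U B : Set E3} (hU : IsOpen U) (hUb : Bornology.IsBounded U)
    (hB : IsCompact B) {D : NNReal} (hD : ∀ x ∈ U, ∀ y ∈ B, ‖y - x‖ ≤ D)
    (hseg : ∀ x ∈ U, ∀ y ∈ B, segment ℝ x y ⊆ Ω.set)
    {u : L2 Ω} {v : Fin 3 → L2 Ω} (h : ∀ i, HasWeakDeriv i u (v i)) :
    ∫⁻ x in U, ∫⁻ y in B, ‖extend u x - extend u y‖ₑ ^ 2 ≤
      (D ^ 2 * 3 * (8 * (volume U + volume B))) * (2 * ∑ i, ‖v i‖ₑ ^ 2) := by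
  obtain ⟨F, hFc, hFU, hFun, hFm⟩ := hU.exists_iUnion_isClosed
  rw [← hFun, setLIntegral_iUnion_of_directed _ hFm.directed_le]
  refine iSup_le fun n => ?_
  refine (lintegral_sq_sub_extend_le_of_isCompact
    (Metric.isCompact_of_isClosed_isBounded (hFc n) (hUb.subset (hFU n))) hB
    (fun x hx => hD x (hFU n hx)) (fun x hx => hseg x (hFU n hx)) h).trans ?_
  gcongr
  exact Set.subset_iUnion F n

/-- The Poincaré inequality on a subset of the domain. -/
def HasPoincare (Ω : LipschitzDomain) (U : Set E3) : Prop :=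
  ∃ C : NNReal, ∀ (u : L2 Ω) (v : Fin 3 → L2 Ω), (∀ i, HasWeakDeriv i u (v i)) →
    ∃ c : ℝ, ∫⁻ x in U, ‖extend u x - c‖ₑ ^ 2 ≤ C * ∑ i, ‖v i‖ₑ ^ 2

theorem hasPoincare_of_star {U B : Set E3} (hU : IsOpen U) (hUb : Bornology.IsBounded U)
    (hB : IsCompact B) (hB0 : volume B ≠ 0)
    (hseg : ∀ x ∈ U, ∀ y ∈ B, segment ℝ x y ⊆ Ω.set) : HasPoincare Ω U := by
  obtain ⟨D, hD⟩ := (hUb.union hB.isBounded).exists_norm_le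
  set D' : NNReal := 2 * D.toNNReal
  have hDD : ∀ x ∈ U, ∀ y ∈ B, ‖y - x‖ ≤ D' := by
    intro x hx y hy
    refine (norm_sub_le _ _).trans ?_
    have h1 := hD y (Or.inr hy)
    have h2 := hD x (Or.inl hx)
    have h3 : (D' : ℝ) = 2 * max D 0 := by simp [D']
    have := le_max_left D 0
    linarith
  have hBt : volume B ≠ ⊤ := hB.measure_lt_top.ne
  have hUt : volume U ≠ ⊤ := hUb.measure_lt_top.ne
  set C : ℝ≥0∞ := (D' ^ 2 * 3 * (8 * (volume U + volume B))) * 2 / volume B with hC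
  have hCt : C ≠ ⊤ := by
    rw [hC]
    exact ENNReal.div_ne_top (by finiteness) hB0
  refine ⟨C.toNNReal, fun u v h => ?_⟩
  rw [ENNReal.coe_toNNReal hCt]
  have hm : Measurable fun p : E3 × E3 => ‖extend u p.1 - extend u p.2‖ₑ ^ 2 :=
    (((measurable_extend u).comp measurable_fst).sub
      ((measurable_extend u).comp measurable_snd)).enorm.pow_const 2
  have hmain := lintegral_sq_sub_extend_le hU hUb hB hDD hseg h
  rw [lintegral_lintegral_swap hm.aemeasurable] at hmain
  obtain ⟨y, -, hy⟩ := exists_le_setLAverage (μ := volume) hB0 hBt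
    (f := fun y => ∫⁻ x in U, ‖extend u x - extend u y‖ₑ ^ 2)
    (Measurable.lintegral_prod_left' (f := fun p : E3 × E3 =>
      ‖extend u p.1 - extend u p.2‖ₑ ^ 2) hm).aemeasurable
  refine ⟨extend u y, hy.trans ?_⟩
  rw [setLAverage_eq, hC, ENNReal.div_eq_inv_mul, ENNReal.div_eq_inv_mul, mul_assoc, mul_assoc]
  gcongr

theorem enorm_add_sq_le (a b : ℝ) : ‖a + b‖ₑ ^ 2 ≤ 2 * (‖a‖ₑ ^ 2 + ‖b‖ₑ ^ 2) :=
  (pow_le_pow_left₀ zero_le (enorm_add_le a b) 2).trans (ennreal_add_sq_le _ _)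

theorem HasPoincare.union {U V : Set E3} (hU : HasPoincare Ω U) (hV : HasPoincare Ω V)
    (hVt : volume V ≠ ⊤) (hUV : volume (U ∩ V) ≠ 0) : HasPoincare Ω (U ∪ V) := by
  obtain ⟨C₁, h₁⟩ := hU
  obtain ⟨C₂, h₂⟩ := hV
  have hUVt : volume (U ∩ V) ≠ ⊤ := ne_top_of_le_ne_top hVt (measure_mono Set.inter_subset_right)
  set R : ℝ≥0∞ := volume V / volume (U ∩ V)
  have hRt : R ≠ ⊤ := ENNReal.div_ne_top hVt hUV
  set C : ℝ≥0∞ := C₁ + 2 * (C₂ + R * (2 * (C₁ + C₂))) with hC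
  have hCt : C ≠ ⊤ := by finiteness
  refine ⟨C.toNNReal, fun u v h => ?_⟩
  rw [ENNReal.coe_toNNReal hCt]
  obtain ⟨c₁, hc₁⟩ := h₁ u v h
  obtain ⟨c₂, hc₂⟩ := h₂ u v h
  set S : ℝ≥0∞ := ∑ i, ‖v i‖ₑ ^ 2
  refine ⟨c₁, ?_⟩
  have hm : ∀ c : ℝ, Measurable fun x => ‖extend u x - c‖ₑ ^ 2 := fun c =>
    ((measurable_extend u).sub_const c).enorm.pow_const 2
  have hdiff : ‖c₂ - c₁‖ₑ ^ 2 * volume (U ∩ V) ≤ 2 * (C₁ + C₂) * S := by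
    rw [← setLIntegral_const]
    calc _ ≤ ∫⁻ x in U ∩ V, 2 * (‖extend u x - c₁‖ₑ ^ 2 + ‖extend u x - c₂‖ₑ ^ 2) := by
          refine lintegral_mono fun x => ?_
          have := enorm_add_sq_le (extend u x - c₁) (-(extend u x - c₂))
          rw [enorm_neg] at this
          convert this using 3
          ring
      _ = 2 * ((∫⁻ x in U ∩ V, ‖extend u x - c₁‖ₑ ^ 2) +
          ∫⁻ x in U ∩ V, ‖extend u x - c₂‖ₑ ^ 2) := by
          rw [lintegral_const_mul' _ _ (by finiteness), lintegral_add_left (hm c₁)]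
      _ ≤ 2 * (C₁ * S + C₂ * S) := by
          gcongr
          · exact (lintegral_mono_set Set.inter_subset_left).trans hc₁
          · exact (lintegral_mono_set Set.inter_subset_right).trans hc₂
      _ = _ := by ring
  have hdiff' : ‖c₂ - c₁‖ₑ ^ 2 * volume V ≤ R * (2 * (C₁ + C₂)) * S := by
    calc _ = R * (‖c₂ - c₁‖ₑ ^ 2 * volume (U ∩ V)) := by
          rw [mul_left_comm, ENNReal.div_mul_cancel hUV hUVt]
      _ ≤ R * (2 * (C₁ + C₂) * S) := by gcongr
      _ = _ := by ring
  calc _ ≤ (∫⁻ x in U, ‖extend u x - c₁‖ₑ ^ 2) + ∫⁻ x in V, ‖extend u x - c₁‖ₑ ^ 2 :=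
        lintegral_union_le _ _ _
    _ ≤ C₁ * S + ∫⁻ x in V, 2 * (‖extend u x - c₂‖ₑ ^ 2 + ‖c₂ - c₁‖ₑ ^ 2) := by
        refine add_le_add hc₁ (lintegral_mono fun x => ?_)
        have := enorm_add_sq_le (extend u x - c₂) (c₂ - c₁)
        rwa [sub_add_sub_cancel] at this
    _ = C₁ * S + 2 * ((∫⁻ x in V, ‖extend u x - c₂‖ₑ ^ 2) + ‖c₂ - c₁‖ₑ ^ 2 * volume V) := by
        rw [lintegral_const_mul' _ _ (by finiteness), lintegral_add_left (hm c₂),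
          setLIntegral_const]
    _ ≤ C₁ * S + 2 * (C₂ * S + R * (2 * (C₁ + C₂)) * S) := by gcongr
    _ = _ := by rw [hC]; ring

theorem hasPoincare_domain (Ω : LipschitzDomain) : HasPoincare Ω Ω.set := by
  have hloc : ∀ x ∈ closure Ω.set, ∃ ρ : ℝ, 0 < ρ ∧ HasPoincare Ω (Metric.ball x ρ ∩ Ω.set) := by
    intro x hx
    obtain ⟨ρ, hρ, b, r, hr, hstar⟩ := exists_star_nhds Ω hx
    refine ⟨ρ, hρ, hasPoincare_of_star (Metric.isOpen_ball.inter Ω.carrier.isOpen)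
      (Metric.isBounded_ball.subset Set.inter_subset_left) (isCompact_closedBall b r)
      (Metric.measure_closedBall_pos volume b hr).ne' hstar⟩
  choose! ρ hρ hP using hloc
  obtain ⟨t, htc, hcov⟩ := (Ω.isBounded.isCompact_closure).elim_nhds_subcover
    (fun x => Metric.ball x (ρ x)) fun x hx => Metric.ball_mem_nhds x (hρ x hx)
  let U : E3 → Set E3 := fun x => Metric.ball x (ρ x) ∩ Ω.set
  have hUo : ∀ x, IsOpen (U x) := fun x => Metric.isOpen_ball.inter Ω.carrier.isOpen
  classical
  let good : Finset E3 → Prop := fun s =>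
    s ⊆ t ∧ (⋃ x ∈ s, U x).Nonempty ∧ HasPoincare Ω (⋃ x ∈ s, U x)
  obtain ⟨z, hz⟩ := Ω.isConnected.nonempty
  have hΩcov : ∀ y ∈ Ω.set, ∃ x ∈ t, y ∈ U x := by
    intro y hy
    have := hcov (subset_closure hy)
    simp only [Set.mem_iUnion, exists_prop] at this
    obtain ⟨x, hx, hyx⟩ := this
    exact ⟨x, hx, hyx, hy⟩
  obtain ⟨x₁, hx₁, hzx₁⟩ := hΩcov z hz
  have hgood : (t.powerset.filter good).Nonempty :=
    ⟨{x₁}, by simpa [good, hx₁] using ⟨⟨z, hzx₁⟩, hP x₁ (htc x₁ hx₁)⟩⟩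
  obtain ⟨s, hs, hmax⟩ := (t.powerset.filter good).exists_max_image Finset.card hgood
  obtain ⟨-, hst, hsne, hsP⟩ := Finset.mem_filter.1 hs
  have hVo : IsOpen (⋃ x ∈ s, U x) := isOpen_biUnion fun x _ => hUo x
  have hall : Ω.set ⊆ ⋃ x ∈ s, U x := by
    by_contra hnot
    obtain ⟨y, hyΩ, hy⟩ := Set.not_subset.1 hnot
    obtain ⟨x₂, hx₂, hyx₂⟩ := hΩcov y hyΩ
    have hx₂s : x₂ ∉ s := fun h => hy (Set.mem_biUnion h hyx₂)
    obtain ⟨w, -, hwV, hwW⟩ := Ω.isConnected.isPreconnected (⋃ x ∈ s, U x)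
      (⋃ x ∈ t \ s, U x) hVo (isOpen_biUnion fun x _ => hUo x)
      (fun q hq => by
        obtain ⟨x, hx, hqx⟩ := hΩcov q hq
        by_cases hxs : x ∈ s
        · exact Or.inl (Set.mem_biUnion hxs hqx)
        · exact Or.inr (Set.mem_biUnion (Finset.mem_sdiff.2 ⟨hx, hxs⟩) hqx))
      (by
        obtain ⟨q, hq⟩ := hsne
        obtain ⟨x, -, hqx⟩ := Set.mem_iUnion₂.1 hq
        exact ⟨q, hqx.2, hq⟩)
      ⟨y, hyΩ, Set.mem_biUnion (Finset.mem_sdiff.2 ⟨hx₂, hx₂s⟩) hyx₂⟩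
    obtain ⟨x₃, hx₃, hwx₃⟩ := Set.mem_iUnion₂.1 hwW
    obtain ⟨hx₃t, hx₃s⟩ := Finset.mem_sdiff.1 hx₃
    have hPn : HasPoincare Ω (⋃ x ∈ insert x₃ s, U x) := by
      rw [Finset.set_biUnion_insert]
      refine (hP x₃ (htc x₃ hx₃t)).union hsP ?_ ?_
      · refine ne_top_of_le_ne_top Ω.isBounded.measure_lt_top.ne (measure_mono ?_)
        exact Set.iUnion₂_subset fun x _ => Set.inter_subset_right
      · exact (((hUo x₃).inter hVo).measure_pos volume ⟨w, hwx₃, hwV⟩).ne'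
    have hmem : insert x₃ s ∈ t.powerset.filter good := by
      have hsub : insert x₃ s ⊆ t := Finset.insert_subset hx₃t hst
      exact Finset.mem_filter.2 ⟨Finset.mem_powerset.2 hsub, hsub,
        ⟨w, Set.mem_biUnion (Finset.mem_insert_self _ _) hwx₃⟩, hPn⟩
    have := hmax _ hmem
    rw [Finset.card_insert_of_notMem hx₃s] at this
    omega
  have heq : (⋃ x ∈ s, U x) = Ω.set :=
    (Set.iUnion₂_subset fun x _ => Set.inter_subset_right).antisymm hall
  rwa [heq] at hsP

/-- The averaged Taylor integral `∫_B ∫₀¹ k(s) m(y - x) f(x + s (y - x)) ds dy`. -/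
def taylorInt (B : Set E3) (k : ℝ → ℝ) (m : E3 → ℝ) (f : E3 → ℝ) (x : E3) : ℝ :=
  ∫ p in B ×ˢ Set.Icc (0 : ℝ) 1, k p.2 * m (p.1 - x) * f (x + p.2 • (p.1 - x))

theorem lintegral_rpow_lt_top :
    ∫⁻ s in Set.Icc (0 : ℝ) 1, ENNReal.ofReal (s ^ (-(1 / 2) : ℝ)) < ⊤ := by
  have h : IntervalIntegrable (fun s : ℝ => s ^ (-(1 / 2) : ℝ)) volume 0 1 :=
    intervalIntegral.intervalIntegrable_rpow' (by norm_num)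
  rw [intervalIntegrable_iff_integrableOn_Icc_of_le zero_le_one] at h
  exact h.lintegral_lt_top

theorem lintegral_segment_le {s : ℝ} (hs : 0 < s) (x : E3) {F : E3 → ℝ≥0∞}
    (hF : Measurable F) :
    ∫⁻ y, F (x + s • (y - x)) = ENNReal.ofReal ((s ^ 3)⁻¹) * ∫⁻ x, F x := by
  have : ∀ y, x + s • (y - x) = s • y + (x - s • x) := fun y => by rw [smul_sub]; abel
  simp only [this]
  exact lintegral_comp_smul_add hs _ hF

theorem volume_restrict_prod_Icc (B : Set E3) :
    (volume : Measure (E3 × ℝ)).restrict (B ×ˢ Set.Icc (0 : ℝ) 1) =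
      (volume.restrict B).prod (volume.restrict (Set.Icc (0 : ℝ) 1)) := by
  rw [Measure.prod_restrict]; rfl

theorem sq_lintegral_segments_le {B : Set E3} (hB : MeasurableSet B) {f : E3 → ℝ}
    (hf : Measurable f) (x : E3) :
    (∫⁻ p in B ×ˢ Set.Icc (0 : ℝ) 1, ENNReal.ofReal p.2 * ‖f (x + p.2 • (p.1 - x))‖ₑ) ^ 2 ≤
      (∫⁻ s in Set.Icc (0 : ℝ) 1, ENNReal.ofReal (s ^ (-(1 / 2) : ℝ))) ^ 2 * volume B *
        sqNorm f := by
  set A := ∫⁻ s in Set.Icc (0 : ℝ) 1, ENNReal.ofReal (s ^ (-(1 / 2) : ℝ)) with hA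
  have hfm : Measurable fun p : E3 × ℝ => ‖f (x + p.2 • (p.1 - x))‖ₑ :=
    (hf.comp (by fun_prop)).enorm
  have hrm : ∀ a : ℝ, Measurable fun p : E3 × ℝ => ENNReal.ofReal (p.2 ^ a) := fun a =>
    (measurable_snd.pow_const a).ennreal_ofReal
  have hrm' : ∀ a : ℝ, Measurable fun s : ℝ => ENNReal.ofReal (s ^ a) := fun a =>
    (measurable_id.pow_const a).ennreal_ofReal
  have hbm : Measurable fun p : E3 × ℝ =>
      ENNReal.ofReal (p.2 ^ (5 / 4 : ℝ)) * ‖f (x + p.2 • (p.1 - x))‖ₑ := (hrm _).mul hfm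
  have hP : MeasurableSet (B ×ˢ Set.Icc (0 : ℝ) 1) := hB.prod measurableSet_Icc
  have e1 : ∫⁻ p in B ×ˢ Set.Icc (0 : ℝ) 1, ENNReal.ofReal p.2 * ‖f (x + p.2 • (p.1 - x))‖ₑ =
      ∫⁻ p in B ×ˢ Set.Icc (0 : ℝ) 1, ENNReal.ofReal (p.2 ^ (-(1 / 4) : ℝ)) *
        (ENNReal.ofReal (p.2 ^ (5 / 4 : ℝ)) * ‖f (x + p.2 • (p.1 - x))‖ₑ) := by
    refine setLIntegral_congr_fun hP fun p hp => ?_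
    obtain ⟨-, h0, -⟩ := hp
    rw [← mul_assoc, ← ENNReal.ofReal_mul (by positivity)]
    congr 2
    rcases h0.eq_or_lt with h | h
    · rw [← h]; norm_num
    · rw [← Real.rpow_add h]; norm_num
  have e2 : ∫⁻ p in B ×ˢ Set.Icc (0 : ℝ) 1, ENNReal.ofReal (p.2 ^ (-(1 / 4) : ℝ)) ^ 2 =
      A * volume B := by
    have : ∫⁻ p in B ×ˢ Set.Icc (0 : ℝ) 1, ENNReal.ofReal (p.2 ^ (-(1 / 4) : ℝ)) ^ 2 =
        ∫⁻ p in B ×ˢ Set.Icc (0 : ℝ) 1, ENNReal.ofReal (p.2 ^ (-(1 / 2) : ℝ)) := by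
      refine setLIntegral_congr_fun hP fun p hp => ?_
      obtain ⟨-, h0, -⟩ := hp
      rw [← ENNReal.ofReal_pow (by positivity), ← Real.rpow_natCast, ← Real.rpow_mul h0]
      norm_num
    rw [this, volume_restrict_prod_Icc, lintegral_prod_symm' _ (hrm _)]
    simp only [lintegral_const, Measure.restrict_apply_univ]
    rw [lintegral_mul_const _ (hrm' _)]
  have e3 : ∫⁻ p in B ×ˢ Set.Icc (0 : ℝ) 1,
      (ENNReal.ofReal (p.2 ^ (5 / 4 : ℝ)) * ‖f (x + p.2 • (p.1 - x))‖ₑ) ^ 2 ≤ A * sqNorm f := by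
    rw [volume_restrict_prod_Icc, lintegral_prod_symm' _ (hbm.pow_const 2),
      hA, ← lintegral_mul_const _ (hrm' _)]
    refine setLIntegral_mono' measurableSet_Icc fun s hs => ?_
    simp only [mul_pow]
    rw [lintegral_const_mul' _ _ (by finiteness)]
    rcases hs.1.eq_or_lt with h | h
    · rw [← h]; norm_num
    · calc _ ≤ ENNReal.ofReal (s ^ (5 / 4 : ℝ)) ^ 2 * ∫⁻ y, ‖f (x + s • (y - x))‖ₑ ^ 2 := by
            gcongr
            exact Measure.restrict_le_self
        _ = ENNReal.ofReal (s ^ (5 / 4 : ℝ)) ^ 2 * (ENNReal.ofReal ((s ^ 3)⁻¹) * sqNorm f) := by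
            rw [lintegral_segment_le h x (F := fun z => ‖f z‖ₑ ^ 2) (hf.enorm.pow_const 2)]
            rfl
        _ = _ := by
            rw [← mul_assoc, ← ENNReal.ofReal_pow (by positivity),
              ← ENNReal.ofReal_mul (by positivity)]
            congr 2
            rw [← Real.rpow_natCast, ← Real.rpow_natCast, ← Real.rpow_neg h.le,
              ← Real.rpow_mul h.le, ← Real.rpow_add h]
            norm_num
        _ ≤ _ := le_rfl
  rw [e1]
  refine (sq_lintegral_mul_le _ (hrm _).aemeasurable hbm.aemeasurable).trans ?_
  rw [e2]
  calc _ ≤ A * volume B * (A * sqNorm f) := by gcongr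
    _ = _ := by ring

section TaylorInt

variable {B N : Set E3} {k : ℝ → ℝ} {m : E3 → ℝ}

theorem measurable_taylorInt_integrand (hk : Continuous k) (hm : Continuous m) {f : E3 → ℝ}
    (hf : Measurable f) (x : E3) :
    Measurable fun p : E3 × ℝ => k p.2 * m (p.1 - x) * f (x + p.2 • (p.1 - x)) :=
  (Continuous.measurable (by fun_prop)).mul (hf.comp (by fun_prop))

/-- Averaged Taylor integrals are bounded by the `L²` norm, uniformly on bounded sets. -/
theorem exists_taylorInt_bound (hB : IsCompact B) (hN : Bornology.IsBounded N)
    (hk : ∀ s ∈ Set.Icc (0 : ℝ) 1, |k s| ≤ 3 * s) (hm : Continuous m) :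
    ∃ K : NNReal, ∀ x ∈ N, ∀ f : E3 → ℝ, Measurable f →
      ∫⁻ p in B ×ˢ Set.Icc (0 : ℝ) 1, ‖k p.2 * m (p.1 - x) * f (x + p.2 • (p.1 - x))‖ₑ ≤
        K * eLpNorm f 2 volume := by
  obtain ⟨D, hD⟩ := (hN.union hB.isBounded).exists_norm_le
  obtain ⟨M, hM⟩ := (isCompact_closedBall (0 : E3) (2 * D)).exists_bound_of_continuousOn
    hm.continuousOn
  set A := ∫⁻ s in Set.Icc (0 : ℝ) 1, ENNReal.ofReal (s ^ (-(1 / 2) : ℝ)) with hA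
  have hAt : A ≠ ⊤ := lintegral_rpow_lt_top.ne
  have hBt : volume B ≠ ⊤ := hB.measure_lt_top.ne
  have hvt : (volume B) ^ (1 / 2 : ℝ) ≠ ⊤ := ENNReal.rpow_ne_top_of_nonneg (by norm_num) hBt
  set K : ℝ≥0∞ := ENNReal.ofReal (3 * M) * (A * (volume B) ^ (1 / 2 : ℝ)) with hK
  have hKt : K ≠ ⊤ := by finiteness
  refine ⟨K.toNNReal, fun x hx f hf => ?_⟩
  rw [ENNReal.coe_toNNReal hKt]
  have h1 : ∫⁻ p in B ×ˢ Set.Icc (0 : ℝ) 1, ENNReal.ofReal p.2 * ‖f (x + p.2 • (p.1 - x))‖ₑ ≤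
      A * (volume B) ^ (1 / 2 : ℝ) * eLpNorm f 2 volume := by
    rw [← ENNReal.pow_le_pow_left_iff two_ne_zero]
    refine (sq_lintegral_segments_le hB.measurableSet hf x).trans (le_of_eq ?_)
    change A ^ 2 * _ * _ = _
    rw [← eLpNorm_two_sq, mul_pow, mul_pow, ← ENNReal.rpow_natCast ((volume B) ^ (1 / 2 : ℝ)),
      ← ENNReal.rpow_mul, show (1 / 2 : ℝ) * (2 : ℕ) = 1 by norm_num, ENNReal.rpow_one]
  rw [hK, mul_assoc]
  calc _ ≤ ∫⁻ p in B ×ˢ Set.Icc (0 : ℝ) 1,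
        ENNReal.ofReal (3 * M) * (ENNReal.ofReal p.2 * ‖f (x + p.2 • (p.1 - x))‖ₑ) := by
        refine setLIntegral_mono' (hB.measurableSet.prod measurableSet_Icc) fun p hp => ?_
        rw [enorm_mul, ← mul_assoc]
        gcongr
        have hs := hp.2
        have hmem : p.1 - x ∈ Metric.closedBall (0 : E3) (2 * D) := by
          rw [mem_closedBall_zero_iff]
          refine (norm_sub_le _ _).trans ?_
          linarith [hD p.1 (Or.inr hp.1), hD x (Or.inl hx)]
        have hMp := hM _ hmem
        have hM0 : 0 ≤ M := (norm_nonneg _).trans hMp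
        rw [← ENNReal.ofReal_mul (by positivity), ← ofReal_norm, norm_mul]
        refine ENNReal.ofReal_le_ofReal ?_
        calc _ ≤ (3 * p.2) * M :=
              mul_le_mul (hk _ hs) hMp (norm_nonneg _) (by linarith [hs.1])
          _ = _ := by ring
    _ = ENNReal.ofReal (3 * M) *
        ∫⁻ p in B ×ˢ Set.Icc (0 : ℝ) 1, ENNReal.ofReal p.2 * ‖f (x + p.2 • (p.1 - x))‖ₑ :=
        lintegral_const_mul' _ _ (by finiteness)
    _ ≤ _ := by gcongr

theorem continuous_taylorInt (hB : IsCompact B) (hk : Continuous k) (hm : Continuous m)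
    {f : E3 → ℝ} (hf : Continuous f) : Continuous (taylorInt B k m f) := by
  have := continuous_parametric_integral_of_continuous (μ := (volume : Measure (E3 × ℝ)))
    (f := fun (x : E3) (p : E3 × ℝ) => k p.2 * m (p.1 - x) * f (x + p.2 • (p.1 - x)))
    (by fun_prop) (hB.prod (isCompact_Icc (a := (0 : ℝ)) (b := 1)))
  exact this

theorem integrableOn_taylorInt (hB : IsCompact B) (hN : Bornology.IsBounded N)
    (hkc : Continuous k) (hk : ∀ s ∈ Set.Icc (0 : ℝ) 1, |k s| ≤ 3 * s) (hm : Continuous m) {f : E3 → ℝ} (hf : Measurable f) (hf2 : MemLp f 2 volume)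
    {x : E3} (hx : x ∈ N) :
    IntegrableOn (fun p : E3 × ℝ => k p.2 * m (p.1 - x) * f (x + p.2 • (p.1 - x)))
      (B ×ˢ Set.Icc (0 : ℝ) 1) volume := by
  obtain ⟨K, hK⟩ := exists_taylorInt_bound hB hN hk hm
  refine ⟨(measurable_taylorInt_integrand hkc hm hf x).aestronglyMeasurable, ?_⟩
  exact (hK x hx f hf).trans_lt (ENNReal.mul_lt_top ENNReal.coe_lt_top hf2.eLpNorm_lt_top)

end TaylorInt

section TaylorInt

variable {B N : Set E3} {k : ℝ → ℝ} {m : E3 → ℝ}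

/-- Averaged Taylor integrals are bounded and Lipschitz with respect to the `L²` norm, uniformly
on bounded sets. -/
theorem exists_taylorInt_lipschitz (hB : IsCompact B) (hN : Bornology.IsBounded N)
    (hkc : Continuous k) (hk : ∀ s ∈ Set.Icc (0 : ℝ) 1, |k s| ≤ 3 * s) (hm : Continuous m) :
    ∃ K : NNReal, (∀ x ∈ N, ∀ f : E3 → ℝ, Measurable f →
        ‖taylorInt B k m f x‖ₑ ≤ K * eLpNorm f 2 volume) ∧
      ∀ x ∈ N, ∀ f g : E3 → ℝ, Continuous f → Measurable g → MemLp g 2 volume →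
        ‖taylorInt B k m f x - taylorInt B k m g x‖ₑ ≤
          K * eLpNorm (fun z => f z - g z) 2 volume := by
  obtain ⟨K, hK⟩ := exists_taylorInt_bound hB hN hk hm
  refine ⟨K, fun x hx f hf => (enorm_integral_le_lintegral_enorm _).trans (hK x hx f hf),
    fun x hx f g hf hg hg2 => ?_⟩
  have hi : IntegrableOn (fun p : E3 × ℝ => k p.2 * m (p.1 - x) * f (x + p.2 • (p.1 - x)))
      (B ×ˢ Set.Icc (0 : ℝ) 1) volume :=
    (Continuous.continuousOn (by fun_prop)).integrableOn_compact (hB.prod isCompact_Icc)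
  rw [taylorInt, taylorInt, ← integral_sub hi (integrableOn_taylorInt hB hN hkc hk hm hg hg2 hx)]
  simp only [← mul_sub]
  exact (enorm_integral_le_lintegral_enorm _).trans
    (hK x hx (fun z => f z - g z) (hf.measurable.sub hg))

theorem tendsto_eLpNorm_mollify {f : E3 → ℝ} (hf : Measurable f) (hf2 : MemLp f 2 volume) :
    Filter.Tendsto (fun n => eLpNorm (fun x => mollify n f x - f x) 2 volume) Filter.atTop
      (𝓝 0) := by
  have h := (tendsto_sqNorm_mollify hf hf2).ennrpow_const (1 / 2 : ℝ)
  rw [ENNReal.zero_rpow_of_pos (by norm_num)] at h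
  refine h.congr fun n => ?_
  rw [← eLpNorm_two_sq, ← ENNReal.rpow_natCast, ← ENNReal.rpow_mul]
  norm_num

theorem tendstoUniformlyOn_taylorInt (hB : IsCompact B) (hN : Bornology.IsBounded N)
    (hkc : Continuous k) (hk : ∀ s ∈ Set.Icc (0 : ℝ) 1, |k s| ≤ 3 * s) (hm : Continuous m)
    {f : E3 → ℝ} (hf : Measurable f) (hf2 : MemLp f 2 volume) :
    TendstoUniformlyOn (fun n => taylorInt B k m (mollify n f)) (taylorInt B k m f)
      Filter.atTop N := by
  obtain ⟨K, -, hK⟩ := exists_taylorInt_lipschitz hB hN hkc hk hm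
  have hlim : Filter.Tendsto (fun n => K * eLpNorm (fun x => mollify n f x - f x) 2 volume)
      Filter.atTop (𝓝 0) := by
    simpa using ENNReal.Tendsto.const_mul (tendsto_eLpNorm_mollify hf hf2)
      (Or.inr ENNReal.coe_ne_top)
  rw [Metric.tendstoUniformlyOn_iff]
  intro ε hε
  filter_upwards [hlim.eventually_lt_const (ENNReal.ofReal_pos.2 hε)] with n hn x hx
  have := (hK x hx _ f (continuous_mollify n (hf2.locallyIntegrable (by norm_num))) hf
    hf2).trans_lt hn
  rw [← ofReal_norm, ENNReal.ofReal_lt_ofReal_iff hε] at this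
  rwa [dist_comm, dist_eq_norm]

theorem continuousOn_taylorInt (hB : IsCompact B) (hN : Bornology.IsBounded N)
    (hkc : Continuous k) (hk : ∀ s ∈ Set.Icc (0 : ℝ) 1, |k s| ≤ 3 * s) (hm : Continuous m)
    {f : E3 → ℝ} (hf : Measurable f) (hf2 : MemLp f 2 volume) :
    ContinuousOn (taylorInt B k m f) N :=
  (tendstoUniformlyOn_taylorInt hB hN hkc hk hm hf hf2).continuousOn
    (Filter.Eventually.of_forall fun n => (continuous_taylorInt hB hkc hm
      (continuous_mollify n (hf2.locallyIntegrable (by norm_num)))).continuousOn).frequently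

end TaylorInt

/-- The averaged second-order Taylor representation. -/
def taylorRep (B : Set E3) (f : E3 → ℝ) (g : Fin 3 → E3 → ℝ) (h : Fin 3 → Fin 3 → E3 → ℝ)
    (x : E3) : ℝ :=
  taylorInt B (fun s => 3 * s ^ 2) (fun _ => 1) f x +
    (∑ i, taylorInt B (fun s => -3 * s ^ 3) (fun y => y i) (g i) x +
    ∑ i, ∑ j, taylorInt B (fun s => s - s ^ 4) (fun y => y i * y j) (h i j) x)

theorem weight_zero_le {s : ℝ} (hs : s ∈ Set.Icc (0 : ℝ) 1) : |3 * s ^ 2| ≤ 3 * s := by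
  obtain ⟨h0, h1⟩ := hs
  rw [abs_of_nonneg (by positivity)]
  nlinarith

theorem weight_one_le {s : ℝ} (hs : s ∈ Set.Icc (0 : ℝ) 1) : |-3 * s ^ 3| ≤ 3 * s := by
  obtain ⟨h0, h1⟩ := hs
  have h2 : s ^ 2 ≤ 1 := pow_le_one₀ h0 h1
  have h3 : 0 ≤ s ^ 3 := by positivity
  rw [abs_of_nonpos (by linarith)]
  nlinarith

theorem weight_two_le {s : ℝ} (hs : s ∈ Set.Icc (0 : ℝ) 1) : |s - s ^ 4| ≤ 3 * s := by
  obtain ⟨h0, h1⟩ := hs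
  have h2 : s ^ 3 ≤ 1 := pow_le_one₀ h0 h1
  have h3 : 0 ≤ s ^ 3 := by positivity
  rw [abs_of_nonneg (by nlinarith)]
  nlinarith

theorem integral_taylor_segment {f : E3 → ℝ} {g : Fin 3 → E3 → ℝ} {h : Fin 3 → Fin 3 → E3 → ℝ}
    (hf : Continuous f) (hg : ∀ i, Continuous (g i)) (hh : ∀ i j, Continuous (h i j)) {x y : E3}
    (hfg : ∀ z ∈ segment ℝ x y,
      HasFDerivAt f (∑ i, g i z • (EuclideanSpace.proj i : E3 →L[ℝ] ℝ)) z)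
    (hgh : ∀ i, ∀ z ∈ segment ℝ x y,
      HasFDerivAt (g i) (∑ j, h i j z • (EuclideanSpace.proj j : E3 →L[ℝ] ℝ)) z) :
    ∫ s in Set.Icc (0 : ℝ) 1, (3 * s ^ 2 * 1 * f (x + s • (y - x)) +
      (∑ i, -3 * s ^ 3 * (y - x) i * g i (x + s • (y - x)) +
      ∑ i, ∑ j, (s - s ^ 4) * ((y - x) i * (y - x) j) * h i j (x + s • (y - x)))) = f x := by
  have hmem : ∀ s ∈ Set.uIcc (0 : ℝ) 1, x + s • (y - x) ∈ segment ℝ x y := by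
    intro s hs
    rw [Set.uIcc_of_le zero_le_one] at hs
    rw [segment_eq_image']
    exact ⟨s, hs, rfl⟩
  have hd : ∀ s ∈ Set.uIcc (0 : ℝ) 1, HasDerivAt (fun s : ℝ => (s ^ 3 - 1) * f (x + s • (y - x)) +
      (s - s ^ 4) * ∑ i, g i (x + s • (y - x)) * (y - x) i)
      (3 * s ^ 2 * 1 * f (x + s • (y - x)) +
      (∑ i, -3 * s ^ 3 * (y - x) i * g i (x + s • (y - x)) +
      ∑ i, ∑ j, (s - s ^ 4) * ((y - x) i * (y - x) j) * h i j (x + s • (y - x)))) s := by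
    intro s hs
    have d1 := hasDerivAt_comp_segment (hfg _ (hmem s hs))
    have d2 := fun i => hasDerivAt_comp_segment (hgh i _ (hmem s hs))
    have d3 : HasDerivAt (fun s : ℝ => ∑ i, g i (x + s • (y - x)) * (y - x) i)
        (∑ i, (∑ j, h i j (x + s • (y - x)) * (y - x) j) * (y - x) i) s :=
      HasDerivAt.fun_sum fun i _ => (d2 i).mul_const _
    have p3 : HasDerivAt (fun s : ℝ => s ^ 3 - 1) (3 * s ^ 2) s := by
      simpa using (hasDerivAt_pow 3 s).sub_const 1
    have p4 : HasDerivAt (fun s : ℝ => s - s ^ 4) (1 - 4 * s ^ 3) s := by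
      simpa using! (hasDerivAt_id s).sub (hasDerivAt_pow 4 s)
    have := (p3.mul d1).add (p4.mul d3)
    refine this.congr_deriv ?_
    simp only [Fin.sum_univ_three]
    ring
  have hFTC := intervalIntegral.integral_eq_sub_of_hasDerivAt hd
    (Continuous.intervalIntegrable (by fun_prop) _ _)
  rw [intervalIntegral.integral_of_le zero_le_one, ← integral_Icc_eq_integral_Ioc] at hFTC
  rw [hFTC]
  simp

theorem taylorRep_eq {B : Set E3} (hB : IsCompact B) {f : E3 → ℝ} {g : Fin 3 → E3 → ℝ}
    {h : Fin 3 → Fin 3 → E3 → ℝ}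
    (hf : Continuous f) (hg : ∀ i, Continuous (g i)) (hh : ∀ i j, Continuous (h i j)) {x : E3}
    (hfg : ∀ y ∈ B, ∀ z ∈ segment ℝ x y,
      HasFDerivAt f (∑ i, g i z • (EuclideanSpace.proj i : E3 →L[ℝ] ℝ)) z)
    (hgh : ∀ i, ∀ y ∈ B, ∀ z ∈ segment ℝ x y,
      HasFDerivAt (g i) (∑ j, h i j z • (EuclideanSpace.proj j : E3 →L[ℝ] ℝ)) z) :
    taylorRep B f g h x = volume.real B * f x := by
  have hi : ∀ F : E3 × ℝ → ℝ, Continuous F → IntegrableOn F (B ×ˢ Set.Icc (0 : ℝ) 1) volume :=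
    fun F hF => hF.continuousOn.integrableOn_compact (hB.prod isCompact_Icc)
  have e : taylorRep B f g h x = ∫ p in B ×ˢ Set.Icc (0 : ℝ) 1,
      (3 * p.2 ^ 2 * 1 * f (x + p.2 • (p.1 - x)) +
      (∑ i, -3 * p.2 ^ 3 * (p.1 - x) i * g i (x + p.2 • (p.1 - x)) +
      ∑ i, ∑ j, (p.2 - p.2 ^ 4) * ((p.1 - x) i * (p.1 - x) j) *
        h i j (x + p.2 • (p.1 - x)))) := by
    rw [integral_add (hi _ (by fun_prop)) (hi _ (by fun_prop)),
      integral_add (hi _ (by fun_prop)) (hi _ (by fun_prop)),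
      integral_finsetSum _ fun i _ => hi _ (by fun_prop),
      integral_finsetSum _ fun i _ => hi _ (by fun_prop)]
    simp only [taylorRep, taylorInt]
    congr 2
    refine Finset.sum_congr rfl fun i _ => ?_
    rw [integral_finsetSum _ fun j _ => hi _ (by fun_prop)]
  rw [e]
  have hvol : (volume : Measure (E3 × ℝ)) = (volume : Measure E3).prod volume := rfl
  rw [hvol, setIntegral_prod _ (hi _ (by fun_prop))]
  rw [setIntegral_congr_fun hB.measurableSet (g := fun _ => f x) fun y hy =>
    integral_taylor_segment hf hg hh (hfg y hy) fun i => hgh i y hy]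
  rw [setIntegral_const, smul_eq_mul]

theorem ae_taylorRep_eq {B N : Set E3} (hB : IsCompact B) (hN : Bornology.IsBounded N)
    (hseg : ∀ x ∈ N ∩ Ω.set, ∀ y ∈ B, segment ℝ x y ⊆ Ω.set)
    {u : L2 Ω} {v : Fin 3 → L2 Ω} {w : Fin 3 → Fin 3 → L2 Ω} (huv : ∀ i, HasWeakDeriv i u (v i))
    (hvw : ∀ i j, HasWeakDeriv j (v i) (w i j)) :
    ∀ᵐ x, x ∈ N ∩ Ω.set → taylorRep B (extend u) (fun i => extend (v i))
      (fun i j => extend (w i j)) x = volume.real B * extend u x := by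
  filter_upwards [ae_tendsto_mollify (locallyIntegrable_extend u)] with x hx hxN
  have hlim : ∀ (k : ℝ → ℝ) (m : E3 → ℝ) (f : L2 Ω), Continuous k → Continuous m →
      (∀ s ∈ Set.Icc (0 : ℝ) 1, |k s| ≤ 3 * s) →
      Filter.Tendsto (fun n => taylorInt B k m (mollify n (extend f)) x) Filter.atTop
        (𝓝 (taylorInt B k m (extend f) x)) := fun k m f hkc hm hk =>
    (tendstoUniformlyOn_taylorInt hB hN hkc hk hm (measurable_extend f)
      (memLp_extend f)).tendsto_at hxN.1
  have h1 : Filter.Tendsto (fun n => taylorRep B (mollify n (extend u))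
      (fun i => mollify n (extend (v i))) (fun i j => mollify n (extend (w i j))) x) Filter.atTop
      (𝓝 (taylorRep B (extend u) (fun i => extend (v i)) (fun i j => extend (w i j)) x)) := by
    refine (hlim _ _ _ (by fun_prop) (by fun_prop) fun s => weight_zero_le).add
      ((tendsto_finsetSum _ fun i _ => hlim _ _ _ (by fun_prop) (by fun_prop)
        fun s => weight_one_le).add
      (tendsto_finsetSum _ fun i _ => tendsto_finsetSum _ fun j _ =>
        hlim _ _ _ (by fun_prop) (by fun_prop) fun s => weight_two_le))
  have h2 := hx.const_mul (volume.real B)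
  refine tendsto_nhds_unique (h1.congr' ?_) h2
  have hsub : {z | ∃ x' ∈ ({x} : Set E3), ∃ y ∈ B, z ∈ segment ℝ x' y} ⊆ Ω.set := by
    rintro z ⟨x', rfl, y, hy, hz⟩
    exact hseg _ hxN y hy hz
  filter_upwards [eventually_closedBall_subset (isCompact_iUnion_segment isCompact_singleton hB)
    hsub] with n hn
  exact taylorRep_eq hB (continuous_mollify n (locallyIntegrable_extend _))
    (fun i => continuous_mollify n (locallyIntegrable_extend _))
    (fun i j => continuous_mollify n (locallyIntegrable_extend _))
    (fun y hy z hz => hasFDerivAt_mollify huv (hn z ⟨x, rfl, y, hy, hz⟩))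
    (fun i y hy z hz => hasFDerivAt_mollify (hvw i) (hn z ⟨x, rfl, y, hy, hz⟩))

theorem exists_taylorInt_extend_bound {B N : Set E3} (hB : IsCompact B)
    (hN : Bornology.IsBounded N) {k : ℝ → ℝ} {m : E3 → ℝ}
    (hkc : Continuous k) (hm : Continuous m) (hk : ∀ s ∈ Set.Icc (0 : ℝ) 1, |k s| ≤ 3 * s) :
    ∃ K : ℝ, 0 ≤ K ∧ ∀ x ∈ N, ∀ f : L2 Ω, |taylorInt B k m (extend f) x| ≤ K * ‖f‖ := by
  obtain ⟨K, hK, -⟩ := exists_taylorInt_lipschitz hB hN hkc hk hm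
  refine ⟨K, K.2, fun x hx f => ?_⟩
  have := hK x hx _ (measurable_extend f)
  have e : eLpNorm (extend f) 2 volume = ‖f‖ₑ := by
    rw [extend, eLpNorm_indicator_eq_eLpNorm_restrict Ω.carrier.isOpen.measurableSet,
      Lp.enorm_def]
  rw [e, ← ofReal_norm, ← ofReal_norm, ← ENNReal.ofReal_coe_nnreal,
    ← ENNReal.ofReal_mul K.coe_nonneg, ENNReal.ofReal_le_ofReal_iff (by positivity)] at this
  exact this

/-- The `W^{2,2}` norm of a function with weak derivatives `v` and `w`. -/
def norm22 (u : L2 Ω) (v : Fin 3 → L2 Ω) (w : Fin 3 → Fin 3 → L2 Ω) : ℝ :=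
  ‖u‖ + (∑ i, ‖v i‖ + ∑ i, ∑ j, ‖w i j‖)

theorem exists_local_sobolev {B N : Set E3} (hB : IsCompact B) (hB0 : volume B ≠ 0)
    (hN : Bornology.IsBounded N)
    (hseg : ∀ x ∈ N ∩ Ω.set, ∀ y ∈ B, segment ℝ x y ⊆ Ω.set) :
    ∃ C : ℝ, 0 ≤ C ∧ ∀ (u : L2 Ω) (v : Fin 3 → L2 Ω) (w : Fin 3 → Fin 3 → L2 Ω),
      (∀ i, HasWeakDeriv i u (v i)) → (∀ i j, HasWeakDeriv j (v i) (w i j)) →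
      ∃ G : E3 → ℝ, ContinuousOn G N ∧ (∀ᵐ x, x ∈ N ∩ Ω.set → G x = extend u x) ∧
        ∀ x ∈ N, |G x| ≤ C * norm22 u v w := by
  obtain ⟨K₀, hK₀, h₀⟩ := exists_taylorInt_extend_bound (Ω := Ω) hB hN
    (k := fun s => 3 * s ^ 2) (m := fun _ => 1) (by fun_prop) (by fun_prop)
    fun s => weight_zero_le
  choose K₁ hK₁ h₁ using fun i : Fin 3 => exists_taylorInt_extend_bound (Ω := Ω) hB hN
    (k := fun s => -3 * s ^ 3) (m := fun y => y i) (by fun_prop) (by fun_prop)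
    fun s => weight_one_le
  choose K₂ hK₂ h₂ using fun i j : Fin 3 => exists_taylorInt_extend_bound (Ω := Ω) hB hN
    (k := fun s => s - s ^ 4) (m := fun y => y i * y j) (by fun_prop) (by fun_prop)
    fun s => weight_two_le
  set K : ℝ := K₀ + (∑ i, K₁ i + ∑ i, ∑ j, K₂ i j) with hK
  have hs1 : 0 ≤ ∑ i, K₁ i := Finset.sum_nonneg fun i _ => hK₁ i
  have hs2 : 0 ≤ ∑ i, ∑ j, K₂ i j :=
    Finset.sum_nonneg fun i _ => Finset.sum_nonneg fun j _ => hK₂ i j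
  have hK0 : 0 ≤ K := by positivity
  have hKK₀ : K₀ ≤ K := by linarith
  have hKK₁ : ∀ i, K₁ i ≤ K := fun i => by
    have := Finset.single_le_sum (f := K₁) (fun i _ => hK₁ i) (Finset.mem_univ i)
    linarith
  have hKK₂ : ∀ i j, K₂ i j ≤ K := fun i j => by
    have a := Finset.single_le_sum (f := K₂ i) (fun j _ => hK₂ i j) (Finset.mem_univ j)
    have b := Finset.single_le_sum (f := fun i => ∑ j, K₂ i j)
      (fun i _ => Finset.sum_nonneg fun j _ => hK₂ i j) (Finset.mem_univ i)
    linarith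
  have hBr : 0 < volume.real B := ENNReal.toReal_pos hB0 hB.measure_lt_top.ne
  refine ⟨(volume.real B)⁻¹ * K, by positivity, fun u v w huv hvw => ?_⟩
  refine ⟨fun x => (volume.real B)⁻¹ * taylorRep B (extend u) (fun i => extend (v i))
      (fun i j => extend (w i j)) x, ?_, ?_, ?_⟩
  · have hc : ∀ (k : ℝ → ℝ) (m : E3 → ℝ) (f : L2 Ω), Continuous k → Continuous m →
        (∀ s ∈ Set.Icc (0 : ℝ) 1, |k s| ≤ 3 * s) → ContinuousOn (taylorInt B k m (extend f)) N :=
      fun k m f hkc hm hk =>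
        continuousOn_taylorInt hB hN hkc hk hm (measurable_extend f) (memLp_extend f)
    refine continuousOn_const.mul ?_
    refine (hc _ _ _ (by fun_prop) (by fun_prop) fun s => weight_zero_le).add
      ((continuousOn_finsetSum _ fun i _ => hc _ _ _ (by fun_prop) (by fun_prop)
        fun s => weight_one_le).add
      (continuousOn_finsetSum _ fun i _ => continuousOn_finsetSum _ fun j _ =>
        hc _ _ _ (by fun_prop) (by fun_prop) fun s => weight_two_le))
  · filter_upwards [ae_taylorRep_eq hB hN hseg huv hvw] with x hx hxN
    rw [hx hxN, inv_mul_cancel_left₀ hBr.ne']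
  · intro x hx
    rw [abs_mul, abs_of_pos (inv_pos.2 hBr), mul_assoc]
    gcongr
    rw [norm22, mul_add, mul_add, Finset.mul_sum, Finset.mul_sum]
    refine (abs_add_le _ _).trans (add_le_add ?_ ((abs_add_le _ _).trans (add_le_add ?_ ?_)))
    · exact (h₀ x hx u).trans (by gcongr)
    · refine (Finset.abs_sum_le_sum_abs _ _).trans (Finset.sum_le_sum fun i _ => ?_)
      exact (h₁ i x hx _).trans (mul_le_mul_of_nonneg_right (hKK₁ i) (norm_nonneg _))
    · refine (Finset.abs_sum_le_sum_abs _ _).trans (Finset.sum_le_sum fun i _ => ?_)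
      rw [Finset.mul_sum]
      refine (Finset.abs_sum_le_sum_abs _ _).trans (Finset.sum_le_sum fun j _ => ?_)
      exact (h₂ i j x hx _).trans (mul_le_mul_of_nonneg_right (hKK₂ i j) (norm_nonneg _))

/-- Functions in `W^{2,2}` of a Lipschitz domain have representatives that are continuous on the
closure and bounded by the Sobolev norm. -/
theorem exists_continuous_rep (Ω : LipschitzDomain) :
    ∃ C : ℝ, 0 ≤ C ∧ ∀ (u : L2 Ω) (v : Fin 3 → L2 Ω) (w : Fin 3 → Fin 3 → L2 Ω),
      (∀ i, HasWeakDeriv i u (v i)) → (∀ i j, HasWeakDeriv j (v i) (w i j)) →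
      ∃ g : E3 → ℝ, ContinuousOn g (closure Ω.set) ∧ u =ᵐ[Ω.vol] g ∧
        ∀ x ∈ closure Ω.set, |g x| ≤ C * norm22 u v w := by
  have hloc : ∀ x ∈ closure Ω.set, ∃ ρ : ℝ, 0 < ρ ∧ ∃ C : ℝ, 0 ≤ C ∧
      ∀ (u : L2 Ω) (v : Fin 3 → L2 Ω) (w : Fin 3 → Fin 3 → L2 Ω),
      (∀ i, HasWeakDeriv i u (v i)) → (∀ i j, HasWeakDeriv j (v i) (w i j)) →
      ∃ G : E3 → ℝ, ContinuousOn G (Metric.ball x ρ) ∧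
        (∀ᵐ y, y ∈ Metric.ball x ρ ∩ Ω.set → G y = extend u y) ∧
        ∀ y ∈ Metric.ball x ρ, |G y| ≤ C * norm22 u v w := by
    intro x hx
    obtain ⟨ρ, hρ, b, r, hr, hstar⟩ := exists_star_nhds Ω hx
    exact ⟨ρ, hρ, exists_local_sobolev (isCompact_closedBall b r)
      (Metric.measure_closedBall_pos volume b hr).ne' Metric.isBounded_ball hstar⟩
  choose! ρ hρ C hC hG using hloc
  obtain ⟨t, htc, hcov⟩ := (Ω.isBounded.isCompact_closure).elim_nhds_subcover
    (fun x => Metric.ball x (ρ x)) fun x hx => Metric.ball_mem_nhds x (hρ x hx)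
  have hcov' : ∀ y ∈ closure Ω.set, ∃ x ∈ t, y ∈ Metric.ball x (ρ x) := by
    intro y hy
    simpa only [Set.mem_iUnion, exists_prop] using hcov hy
  refine ⟨∑ x ∈ t, C x, Finset.sum_nonneg fun x hx => hC x (htc x hx), ?_⟩
  intro u v w huv hvw
  have hn : 0 ≤ norm22 u v w := by unfold norm22; positivity
  have hG' := fun x hx => hG x hx u v w huv hvw
  choose! G hGc hGu hGb using hG'
  have hagree : ∀ x ∈ closure Ω.set, ∀ x' ∈ closure Ω.set,
      Set.EqOn (G x) (G x') ((Metric.ball x (ρ x) ∩ Metric.ball x' (ρ x')) ∩ closure Ω.set) := by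
    intro x hx x' hx'
    have hO : IsOpen (Metric.ball x (ρ x) ∩ Metric.ball x' (ρ x')) :=
      Metric.isOpen_ball.inter Metric.isOpen_ball
    have hOΩ : IsOpen ((Metric.ball x (ρ x) ∩ Metric.ball x' (ρ x')) ∩ Ω.set) :=
      hO.inter Ω.carrier.isOpen
    have c1 : ContinuousOn (G x) (Metric.ball x (ρ x) ∩ Metric.ball x' (ρ x')) :=
      (hGc x hx).mono Set.inter_subset_left
    have c2 : ContinuousOn (G x') (Metric.ball x (ρ x) ∩ Metric.ball x' (ρ x')) :=
      (hGc x' hx').mono Set.inter_subset_right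
    have hae : G x =ᵐ[volume.restrict ((Metric.ball x (ρ x) ∩ Metric.ball x' (ρ x')) ∩ Ω.set)]
        G x' := by
      refine (ae_restrict_iff' hOΩ.measurableSet).2 ?_
      filter_upwards [hGu x hx, hGu x' hx'] with y h1 h2 hy
      rw [h1 ⟨hy.1.1, hy.2⟩, h2 ⟨hy.1.2, hy.2⟩]
    have heq := Measure.eqOn_open_of_ae_eq hae hOΩ (c1.mono Set.inter_subset_left)
      (c2.mono Set.inter_subset_left)
    exact heq.of_subset_closure (c1.mono Set.inter_subset_left) (c2.mono Set.inter_subset_left)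
      (Set.inter_subset_inter_right _ subset_closure) hO.inter_closure
  have hg : ∀ x ∈ closure Ω.set, ∀ y ∈ Metric.ball x (ρ x) ∩ closure Ω.set, G y y = G x y :=
    fun x hx y hy => hagree y hy.2 x hx ⟨⟨Metric.mem_ball_self (hρ y hy.2), hy.1⟩, hy.2⟩
  refine ⟨fun y => G y y, ?_, ?_, ?_⟩
  · intro x hx
    have hball := Metric.ball_mem_nhds x (hρ x hx)
    have h1 : ContinuousWithinAt (G x) (closure Ω.set) x :=
      ((hGc x hx).continuousAt hball).continuousWithinAt
    refine h1.congr_of_eventuallyEq ?_ rfl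
    filter_upwards [mem_nhdsWithin_of_mem_nhds hball, self_mem_nhdsWithin] with y hy1 hy2
    exact hg x hx y ⟨hy1, hy2⟩
  · refine (ae_restrict_iff' Ω.carrier.isOpen.measurableSet).2 ?_
    have hall : ∀ᵐ y, ∀ x ∈ t, y ∈ Metric.ball x (ρ x) ∩ Ω.set → G x y = extend u y :=
      (ae_ball_iff t.countable_toSet).2 fun x hx => hGu x (htc x hx)
    filter_upwards [hall] with y hy hyΩ
    obtain ⟨x, hxt, hyx⟩ := hcov' y (subset_closure hyΩ)
    rw [hg x (htc x hxt) y ⟨hyx, subset_closure hyΩ⟩, hy x hxt ⟨hyx, hyΩ⟩, extend,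
      Set.indicator_of_mem hyΩ]
  · intro y hy
    obtain ⟨x, hxt, hyx⟩ := hcov' y hy
    simp only
    rw [hg x (htc x hxt) y ⟨hyx, hy⟩]
    refine (hGb x (htc x hxt) y hyx).trans (mul_le_mul_of_nonneg_right ?_ hn)
    exact Finset.single_le_sum (f := C) (fun x hx => hC x (htc x hx)) hxt

theorem hasWeakDeriv_gradW (i : Fin 3) (u : W22 Ω) :
    HasWeakDeriv i (W22.toL2 u) (gradW i u : L2 Ω) :=
  hasWeakDeriv_weakDeriv i (u : W12 Ω)

theorem hasWeakDeriv_hessW (i j : Fin 3) (u : W22 Ω) :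
    HasWeakDeriv j (gradW i u : L2 Ω) (hessW i j u) :=
  hasWeakDeriv_weakDeriv j (gradW i u)

theorem norm22_eq_sobolevNorm (u : W22 Ω) :
    norm22 (W22.toL2 u) (fun i => (gradW i u : L2 Ω)) (fun i j => hessW i j u) =
      sobolevNorm u := by
  rw [norm22, sobolevNorm, add_assoc]

theorem sobolevNorm_nonneg (u : W22 Ω) : 0 ≤ sobolevNorm u := by
  unfold sobolevNorm; positivity

theorem sobolevNorm_add_le (u v : W22 Ω) : sobolevNorm (u + v) ≤ sobolevNorm u + sobolevNorm v := by
  unfold sobolevNorm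
  simp only [map_add, Submodule.coe_add]
  have h0 := norm_add_le (W22.toL2 u) (W22.toL2 v)
  have h1 : ∑ i, ‖(gradW i u : L2 Ω) + (gradW i v : L2 Ω)‖ ≤
      ∑ i, ‖(gradW i u : L2 Ω)‖ + ∑ i, ‖(gradW i v : L2 Ω)‖ := by
    rw [← Finset.sum_add_distrib]
    exact Finset.sum_le_sum fun i _ => norm_add_le _ _
  have h2 : ∑ i, ∑ j, ‖hessW i j u + hessW i j v‖ ≤
      ∑ i, ∑ j, ‖hessW i j u‖ + ∑ i, ∑ j, ‖hessW i j v‖ := by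
    simp only [← Finset.sum_add_distrib]
    exact Finset.sum_le_sum fun i _ => Finset.sum_le_sum fun j _ => norm_add_le _ _
  linarith

theorem sobolevNorm_neg (u : W22 Ω) : sobolevNorm (-u) = sobolevNorm u := by
  unfold sobolevNorm
  simp only [map_neg, Submodule.coe_neg, norm_neg]

theorem norm_toL2_le_sobolevNorm (u : W22 Ω) : ‖W22.toL2 u‖ ≤ sobolevNorm u := by
  unfold sobolevNorm
  have h1 : 0 ≤ ∑ i, ‖(gradW i u : L2 Ω)‖ := Finset.sum_nonneg fun i _ => norm_nonneg _
  have h2 : 0 ≤ ∑ i, ∑ j, ‖hessW i j u‖ :=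
    Finset.sum_nonneg fun i _ => Finset.sum_nonneg fun j _ => norm_nonneg _
  linarith

theorem norm_gradW_le_sobolevNorm (i : Fin 3) (u : W22 Ω) :
    ‖(gradW i u : L2 Ω)‖ ≤ sobolevNorm u := by
  unfold sobolevNorm
  have h0 : 0 ≤ ‖W22.toL2 u‖ := norm_nonneg _
  have h1 := Finset.single_le_sum (f := fun i => ‖(gradW i u : L2 Ω)‖)
    (fun i _ => norm_nonneg _) (Finset.mem_univ i)
  have h2 : 0 ≤ ∑ i, ∑ j, ‖hessW i j u‖ :=
    Finset.sum_nonneg fun i _ => Finset.sum_nonneg fun j _ => norm_nonneg _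
  linarith

theorem W22.toL2_injective : Function.Injective (W22.toL2 (Ω := Ω)) := fun _ _ h =>
  Subtype.ext (Subtype.ext h)

theorem eq_zero_of_sobolevNorm_eq_zero {u : W22 Ω} (h : sobolevNorm u = 0) : u = 0 := by
  have h0 := norm_toL2_le_sobolevNorm u
  rw [h] at h0
  exact W22.toL2_injective ((norm_le_zero_iff.1 h0).trans (map_zero _).symm)

theorem enorm_sq_eq_lintegral (f : L2 Ω) : ‖f‖ₑ ^ 2 = ∫⁻ x in Ω.set, ‖f x‖ₑ ^ 2 := by
  rw [Lp.enorm_def, eLpNorm_eq_lintegral_rpow_enorm_toReal (by norm_num) (by norm_num),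
    ← ENNReal.rpow_two, ← ENNReal.rpow_mul]
  simp

theorem exists_poincare (Ω : LipschitzDomain) :
    ∃ C : ℝ, 0 ≤ C ∧ ∀ u : W12 Ω, ∃ c : ℝ,
      ‖((u - constW Ω c : W12 Ω) : L2 Ω)‖ ≤ C * ∑ i, ‖weakDeriv i u‖ := by
  obtain ⟨C, hC⟩ := hasPoincare_domain Ω
  refine ⟨√C, Real.sqrt_nonneg _, fun u => ?_⟩
  obtain ⟨c, hc⟩ := hC u (fun i => weakDeriv i u) fun i => hasWeakDeriv_weakDeriv i u
  refine ⟨c, ?_⟩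
  have e : ‖((u - constW Ω c : W12 Ω) : L2 Ω)‖ₑ ^ 2 =
      ∫⁻ x in Ω.set, ‖extend (u : L2 Ω) x - c‖ₑ ^ 2 := by
    rw [enorm_sq_eq_lintegral]
    refine lintegral_congr_ae ?_
    filter_upwards [Lp.coeFn_sub (u : L2 Ω) (Lp.const 2 Ω.vol c), Lp.coeFn_const 2 Ω.vol c,
      ae_restrict_mem Ω.carrier.isOpen.measurableSet] with x h1 h2 h3
    change ‖((u : L2 Ω) - Lp.const 2 Ω.vol c) x‖ₑ ^ 2 = _
    rw [h1, Pi.sub_apply, h2, extend, Set.indicator_of_mem h3, Function.const_apply]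
  rw [← e] at hc
  have hr : ‖((u - constW Ω c : W12 Ω) : L2 Ω)‖ ^ 2 ≤ C * ∑ i, ‖weakDeriv i u‖ ^ 2 := by
    have := ENNReal.toReal_mono (ENNReal.mul_ne_top ENNReal.coe_ne_top
      (ENNReal.sum_ne_top.2 fun i _ => by finiteness)) hc
    rw [ENNReal.toReal_pow, toReal_enorm, ENNReal.toReal_mul, ENNReal.toReal_sum
      (fun i _ => by finiteness)] at this
    simpa [ENNReal.toReal_pow, toReal_enorm] using this
  have hs : ∑ i, ‖weakDeriv i u‖ ^ 2 ≤ (∑ i, ‖weakDeriv i u‖) ^ 2 :=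
    Finset.sum_sq_le_sq_sum_of_nonneg fun i _ => norm_nonneg _
  refine abs_le_of_sq_le_sq' ?_ (by positivity) |>.2
  rw [mul_pow, Real.sq_sqrt C.coe_nonneg]
  exact hr.trans (mul_le_mul_of_nonneg_left hs C.coe_nonneg)

theorem eq_zero_of_weakDeriv_eq_zero {u : W12 Ω} (hu : u ∈ meanZero Ω)
    (h : ∀ i, weakDeriv i u = 0) : u = 0 := by
  obtain ⟨C, -, hC⟩ := exists_poincare Ω
  obtain ⟨c, hc⟩ := hC u
  simp only [h, norm_zero, Finset.sum_const_zero, mul_zero, norm_le_zero_iff] at hc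
  have hc' : u = constW Ω c := sub_eq_zero.1 (Subtype.ext hc)
  have hint : ∫ x in Ω.set, (u : L2 Ω) x = 0 := hu
  have h2 : ∫ x in Ω.set, (u : L2 Ω) x = volume.real Ω.set * c := by
    rw [hc', ← smul_eq_mul, ← setIntegral_const]
    refine integral_congr_ae ?_
    filter_upwards [Lp.coeFn_const 2 Ω.vol c] with x hx
    exact hx
  rw [h2] at hint
  rcases mul_eq_zero.1 hint with h3 | h3
  · exact absurd h3 (volume_real_pos Ω).ne'
  · rw [hc', h3, map_zero]

theorem memLp_of_continuous {f : E3 → ℝ} (hf : Continuous f) : MemLp f 2 Ω.vol := by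
  obtain ⟨C, hC⟩ := Ω.isBounded.isCompact_closure.exists_bound_of_continuousOn hf.continuousOn
  refine MemLp.of_bound hf.aestronglyMeasurable C ?_
  filter_upwards [ae_restrict_mem Ω.carrier.isOpen.measurableSet] with x hx
  exact hC x (subset_closure hx)

variable (Ω) in
/-- The class in `L²(Ω)` of a continuous function on `ℝ³`. -/
def continuousL2 (f : E3 → ℝ) (hf : Continuous f) : L2 Ω := (memLp_of_continuous hf).toLp f

theorem coeFn_continuousL2 {f : E3 → ℝ} (hf : Continuous f) :
    continuousL2 Ω f hf =ᵐ[Ω.vol] f := MemLp.coeFn_toLp _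

theorem continuous_partial {f : E3 → ℝ} (hf : ContDiff ℝ ∞ f) (i : Fin 3) :
    Continuous fun x => fderiv ℝ f x (EuclideanSpace.single i 1) :=
  (hf.continuous_fderiv (by simp)).clm_apply continuous_const

theorem contDiff_partial {f : E3 → ℝ} (hf : ContDiff ℝ ∞ f) (i : Fin 3) :
    ContDiff ℝ ∞ fun x => fderiv ℝ f x (EuclideanSpace.single i 1) :=
  (hf.fderiv_right (m := ∞) (by simp)).clm_apply contDiff_const

/-- The classical partial derivatives of a smooth function are its weak derivatives. -/
theorem hasWeakDeriv_continuousL2 {f : E3 → ℝ} (hf : ContDiff ℝ ∞ f) (i : Fin 3) :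
    HasWeakDeriv i (continuousL2 Ω f hf.continuous)
      (continuousL2 Ω (fun x => fderiv ℝ f x (EuclideanSpace.single i 1))
        (continuous_partial hf i)) := by
  intro φ hφ hc hs
  have e1 : ∫ x in Ω.set, continuousL2 Ω f hf.continuous x *
        fderiv ℝ φ x (EuclideanSpace.single i 1) =
      ∫ x in Ω.set, f x * fderiv ℝ φ x (EuclideanSpace.single i 1) := by
    refine integral_congr_ae ?_
    filter_upwards [coeFn_continuousL2 (Ω := Ω) hf.continuous] with x hx
    rw [hx]
  have e2 : ∫ x in Ω.set, continuousL2 Ω (fun x => fderiv ℝ f x (EuclideanSpace.single i 1))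
        (continuous_partial hf i) x * φ x =
      ∫ x in Ω.set, fderiv ℝ f x (EuclideanSpace.single i 1) * φ x := by
    refine integral_congr_ae ?_
    filter_upwards [coeFn_continuousL2 (Ω := Ω) (continuous_partial hf i)] with x hx
    rw [hx]
  have z1 : ∀ x, x ∉ Ω.set → f x * fderiv ℝ φ x (EuclideanSpace.single i 1) = 0 := by
    intro x hx
    have : x ∉ tsupport (fderiv ℝ φ) := fun h => hx (hs (tsupport_fderiv_subset ℝ h))
    rw [image_eq_zero_of_notMem_tsupport this]
    simp
  have z2 : ∀ x, x ∉ Ω.set → fderiv ℝ f x (EuclideanSpace.single i 1) * φ x = 0 := by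
    intro x hx
    rw [image_eq_zero_of_notMem_tsupport fun h => hx (hs h), mul_zero]
  rw [e1, e2, setIntegral_eq_integral_of_forall_compl_eq_zero z1,
    setIntegral_eq_integral_of_forall_compl_eq_zero z2]
  refine integral_mul_fderiv_eq_neg_fderiv_mul_of_integrable ?_ ?_ ?_
    (fun x _ => hf.differentiable (by simp) x) (fun x _ => hφ.differentiable (by simp) x)
  · exact ((continuous_partial hf i).mul hφ.continuous).integrable_of_hasCompactSupport
      hc.mul_left
  · exact (hf.continuous.mul (continuous_partial hφ i)).integrable_of_hasCompactSupport
      (hc.fderiv_apply ℝ _).mul_left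
  · exact (hf.continuous.mul hφ.continuous).integrable_of_hasCompactSupport hc.mul_left

variable (Ω) in
/-- The class in `W^{1,2}(Ω)` of a smooth function on `ℝ³`. -/
def smoothW12 (f : E3 → ℝ) (hf : ContDiff ℝ ∞ f) : W12 Ω :=
  ⟨continuousL2 Ω f hf.continuous, fun i => ⟨_, hasWeakDeriv_continuousL2 hf i⟩⟩

theorem weakDeriv_smoothW12 {f : E3 → ℝ} (hf : ContDiff ℝ ∞ f) (i : Fin 3) :
    weakDeriv i (smoothW12 Ω f hf) = continuousL2 Ω
      (fun x => fderiv ℝ f x (EuclideanSpace.single i 1)) (continuous_partial hf i) :=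
  (hasWeakDeriv_weakDeriv i _).unique (hasWeakDeriv_continuousL2 hf i)

variable (Ω) in
/-- The class in `W^{2,2}(Ω)` of a smooth function on `ℝ³`. -/
def smoothW22 (f : E3 → ℝ) (hf : ContDiff ℝ ∞ f) : W22 Ω :=
  ⟨smoothW12 Ω f hf, (Submodule.mem_iInf _).2 fun i => by
    rw [Submodule.mem_comap, weakDeriv_smoothW12]
    exact (smoothW12 Ω _ (contDiff_partial hf i)).2⟩

theorem gradW_smoothW22 {f : E3 → ℝ} (hf : ContDiff ℝ ∞ f) (i : Fin 3) :
    gradW i (smoothW22 Ω f hf) =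
      smoothW12 Ω (fun x => fderiv ℝ f x (EuclideanSpace.single i 1)) (contDiff_partial hf i) :=
  Subtype.ext (weakDeriv_smoothW12 hf i)

theorem hessW_smoothW22 {f : E3 → ℝ} (hf : ContDiff ℝ ∞ f) (i j : Fin 3) :
    hessW i j (smoothW22 Ω f hf) = continuousL2 Ω
      (fun x => fderiv ℝ (fun x => fderiv ℝ f x (EuclideanSpace.single i 1)) x
        (EuclideanSpace.single j 1)) (continuous_partial (contDiff_partial hf i) j) := by
  change weakDeriv j (gradW i (smoothW22 Ω f hf)) = _
  rw [gradW_smoothW22, weakDeriv_smoothW12]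

theorem contDiff_affine (a : ℝ) (b : E3) : ContDiff ℝ ∞ fun x : E3 => a + inner ℝ b x :=
  contDiff_const.add (contDiff_const.inner ℝ contDiff_id)

theorem fderiv_affine (a : ℝ) (b : E3) (x : E3) (i : Fin 3) :
    fderiv ℝ (fun x : E3 => a + inner ℝ b x) x (EuclideanSpace.single i 1) = b i := by
  have h : HasFDerivAt (fun x : E3 => a + inner ℝ b x) (innerSL ℝ b) x :=
    (innerSL ℝ b).hasFDerivAt.const_add a
  rw [h.fderiv]
  simp [EuclideanSpace.inner_single_right]

variable (Ω) in
/-- Affine functions as elements of `W^{2,2}(Ω)`. -/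
def affineW22 (a : ℝ) (b : E3) : W22 Ω := smoothW22 Ω _ (contDiff_affine a b)

theorem toL2_affineW22 (a : ℝ) (b : E3) :
    W22.toL2 (affineW22 Ω a b) =ᵐ[Ω.vol] fun x => a + inner ℝ b x :=
  coeFn_continuousL2 (contDiff_affine a b).continuous

theorem gradW_affineW22 (a : ℝ) (b : E3) (i : Fin 3) :
    gradW i (affineW22 Ω a b) = constW Ω (b i) := by
  rw [affineW22, gradW_smoothW22]
  refine Subtype.ext (Lp.ext ?_)
  refine (coeFn_continuousL2 (continuous_partial (contDiff_affine a b) i)).trans ?_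
  filter_upwards [Lp.coeFn_const 2 Ω.vol (b i)] with x hx
  rw [fderiv_affine]
  exact hx.symm

theorem hessW_affineW22 (a : ℝ) (b : E3) (i j : Fin 3) : hessW i j (affineW22 Ω a b) = 0 := by
  change weakDeriv j (gradW i (affineW22 Ω a b)) = 0
  rw [gradW_affineW22, weakDeriv_constW]

theorem sub_affineW22_constant (u : W22 Ω) (a : ℝ) (b : E3) :
    W22.toL2 (u - affineW22 Ω a b) =
      (((u - affineW22 Ω 0 b : W22 Ω) : W12 Ω) - constW Ω a : W12 Ω) := by
  refine Lp.ext ?_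
  change (W22.toL2 u - W22.toL2 (affineW22 Ω a b) : L2 Ω) =ᵐ[Ω.vol]
    ((W22.toL2 u - W22.toL2 (affineW22 Ω 0 b) - Lp.const 2 Ω.vol a : L2 Ω))
  filter_upwards [Lp.coeFn_sub (W22.toL2 u) (W22.toL2 (affineW22 Ω a b)),
    Lp.coeFn_sub (W22.toL2 u - W22.toL2 (affineW22 Ω 0 b)) (Lp.const 2 Ω.vol a),
    Lp.coeFn_sub (W22.toL2 u) (W22.toL2 (affineW22 Ω 0 b)), Lp.coeFn_const 2 Ω.vol a,
    toL2_affineW22 (Ω := Ω) a b, toL2_affineW22 (Ω := Ω) 0 b] with x h1 h2 h3 h4 h5 h6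
  rw [h1, h2, Pi.sub_apply, Pi.sub_apply, h3, Pi.sub_apply, h4, h5, h6, Function.const_apply]
  ring

/-- Modulo affine functions, the `W^{2,2}` norm is controlled by the second derivatives. -/
theorem exists_affine_approx (Ω : LipschitzDomain) : ∃ C : ℝ, 0 ≤ C ∧ ∀ u : W22 Ω,
    ∃ (a : ℝ) (b : E3), sobolevNorm (u - affineW22 Ω a b) ≤ C * ∑ i, ∑ j, ‖hessW i j u‖ := by
  obtain ⟨C, hC0, hC⟩ := exists_poincare Ω
  refine ⟨C * C + C + 1, by positivity, fun u => ?_⟩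
  choose b hb using fun i => hC (gradW i u)
  obtain ⟨a, ha⟩ := hC ((u - affineW22 Ω 0 (WithLp.toLp 2 b) : W22 Ω) : W12 Ω)
  refine ⟨a, WithLp.toLp 2 b, ?_⟩
  set b' : E3 := WithLp.toLp 2 b
  set H := ∑ i, ∑ j, ‖hessW i j u‖ with hH
  have hgrad : ∀ a i, (gradW i (u - affineW22 Ω a b') : L2 Ω) =
      ((gradW i u - constW Ω (b i) : W12 Ω) : L2 Ω) := by
    intro a i
    rw [map_sub, gradW_affineW22]
  have hhess : ∀ i j, hessW i j (u - affineW22 Ω a b') = hessW i j u := by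
    intro i j
    rw [map_sub, hessW_affineW22, sub_zero]
  have h1 : ∑ i, ‖(gradW i (u - affineW22 Ω a b') : L2 Ω)‖ ≤ C * H := by
    rw [hH, Finset.mul_sum]
    refine Finset.sum_le_sum fun i _ => ?_
    rw [hgrad]
    exact hb i
  have h2 : ‖W22.toL2 (u - affineW22 Ω a b')‖ ≤ C * (C * H) := by
    rw [sub_affineW22_constant]
    refine ha.trans (mul_le_mul_of_nonneg_left ?_ hC0)
    rw [hH, Finset.mul_sum]
    refine Finset.sum_le_sum fun i _ => ?_
    change ‖(gradW i (u - affineW22 Ω 0 b') : L2 Ω)‖ ≤ _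
    rw [hgrad]
    exact hb i
  unfold sobolevNorm
  simp only [hhess]
  calc _ ≤ C * (C * H) + C * H + H := add_le_add (add_le_add h2 h1) le_rfl
    _ = _ := by ring

theorem HasWeakDeriv.of_tendsto {i : Fin 3} {u v : ℕ → L2 Ω} {u' v' : L2 Ω}
    (h : ∀ n, HasWeakDeriv i (u n) (v n)) (hu : Filter.Tendsto u Filter.atTop (𝓝 u'))
    (hv : Filter.Tendsto v Filter.atTop (𝓝 v')) : HasWeakDeriv i u' v' := by
  intro φ hφ hc hs
  have key : ∀ (ψ : E3 → ℝ) (hψ : Continuous ψ) (f : L2 Ω),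
      ∫ x in Ω.set, f x * ψ x = inner ℝ f (continuousL2 Ω ψ hψ) := by
    intro ψ hψ f
    rw [L2.inner_def]
    refine integral_congr_ae ?_
    filter_upwards [coeFn_continuousL2 (Ω := Ω) hψ] with x hx
    rw [hx]
    exact mul_comm _ _
  rw [key _ (continuous_partial hφ i), key _ hφ.continuous]
  refine tendsto_nhds_unique (hu.inner tendsto_const_nhds) ?_
  refine (hv.inner tendsto_const_nhds).neg.congr fun n => ?_
  rw [← key, ← key]
  exact (h n φ hφ hc hs).symm

variable {π : W22 Ω →ₗ[ℝ] W22 Ω}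

theorem norm_hessW_le (ψ : DotW22 π) (i j : Fin 3) : ‖hessW i j ψ.incl‖ ≤ ‖ψ‖ :=
  PiLp.norm_apply_le (DotW22.hess ψ) (i, j)

theorem norm_le_sobolevNorm (ψ : DotW22 π) : ‖ψ‖ ≤ sobolevNorm ψ.incl := by
  have h1 : ‖ψ‖ = √(∑ p : Fin 3 × Fin 3, ‖hessW p.1 p.2 ψ.incl‖ ^ 2) :=
    PiLp.norm_eq_of_L2 (DotW22.hess ψ)
  have h2 : ∑ p : Fin 3 × Fin 3, ‖hessW p.1 p.2 ψ.incl‖ ^ 2 ≤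
      (∑ p : Fin 3 × Fin 3, ‖hessW p.1 p.2 ψ.incl‖) ^ 2 :=
    Finset.sum_sq_le_sq_sum_of_nonneg fun i _ => norm_nonneg _
  have h3 : ∑ p : Fin 3 × Fin 3, ‖hessW p.1 p.2 ψ.incl‖ = ∑ i, ∑ j, ‖hessW i j ψ.incl‖ :=
    Fintype.sum_prod_type _
  rw [h1]
  refine (Real.sqrt_le_sqrt h2).trans ?_
  rw [Real.sqrt_sq (Finset.sum_nonneg fun p _ => norm_nonneg _), h3]
  unfold sobolevNorm
  have h4 : 0 ≤ ‖W22.toL2 ψ.incl‖ := norm_nonneg _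
  have h5 : 0 ≤ ∑ i, ‖(gradW i ψ.incl : L2 Ω)‖ := Finset.sum_nonneg fun i _ => norm_nonneg _
  linarith

theorem DotW22.map_incl (ψ : DotW22 π) : π ψ.incl = 0 := LinearMap.mem_ker.1 ψ.2

theorem exists_sobolevNorm_le (hπ : IsAffineProjection π) : ∃ C : ℝ, 0 ≤ C ∧ ∀ ψ : DotW22 π,
    sobolevNorm ψ.incl ≤ C * ‖ψ‖ := by
  obtain ⟨C, hC0, hC⟩ := exists_affine_approx Ω
  obtain ⟨M, hM⟩ := hπ.bounded
  refine ⟨(1 + |M|) * (C * 9), by positivity, fun ψ => ?_⟩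
  obtain ⟨a, b, hab⟩ := hC ψ.incl
  set p := affineW22 Ω a b
  have hp : π p = p := hπ.fix p ⟨a, b, toL2_affineW22 a b⟩
  have e : ψ.incl = (ψ.incl - p) + -π (ψ.incl - p) := by
    rw [map_sub, ψ.map_incl, hp]; abel
  have h9 : ∑ i, ∑ j, ‖hessW i j ψ.incl‖ ≤ 9 * ‖ψ‖ := by
    calc _ ≤ ∑ _i : Fin 3, ∑ _j : Fin 3, ‖ψ‖ :=
          Finset.sum_le_sum fun i _ => Finset.sum_le_sum fun j _ => norm_hessW_le ψ i j
      _ = 9 * ‖ψ‖ := by simp; ring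
  have hMa : sobolevNorm (π (ψ.incl - p)) ≤ |M| * sobolevNorm (ψ.incl - p) :=
    (hM _).trans (mul_le_mul_of_nonneg_right (le_abs_self M) (sobolevNorm_nonneg _))
  have hA : sobolevNorm (ψ.incl - p) ≤ C * 9 * ‖ψ‖ := by
    refine hab.trans ?_
    rw [mul_assoc]
    exact mul_le_mul_of_nonneg_left h9 hC0
  calc sobolevNorm ψ.incl ≤ sobolevNorm (ψ.incl - p) + sobolevNorm (-π (ψ.incl - p)) := by
        conv_lhs => rw [e]
        exact sobolevNorm_add_le _ _
    _ ≤ (1 + |M|) * sobolevNorm (ψ.incl - p) := by rw [sobolevNorm_neg]; linarith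
    _ ≤ (1 + |M|) * (C * 9 * ‖ψ‖) := mul_le_mul_of_nonneg_left hA (by positivity)
    _ = _ := by ring

theorem DotW22.eq_zero_of_norm_eq_zero (hπ : IsAffineProjection π) {ψ : DotW22 π}
    (h : ‖ψ‖ = 0) : ψ = 0 := by
  obtain ⟨C, -, hC⟩ := exists_sobolevNorm_le hπ
  have h1 := hC ψ
  rw [h, mul_zero] at h1
  exact Subtype.ext (eq_zero_of_sobolevNorm_eq_zero (h1.antisymm (sobolevNorm_nonneg _)))

theorem DotW22.t0Space (hπ : IsAffineProjection π) : T0Space (DotW22 π) := by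
  refine ⟨fun x y hxy => ?_⟩
  have h : dist x y = 0 := Metric.inseparable_iff.1 hxy
  rw [dist_eq_norm] at h
  exact sub_eq_zero.1 (DotW22.eq_zero_of_norm_eq_zero hπ h)

theorem DotW22.completeSpace (hπ : IsAffineProjection π) : CompleteSpace (DotW22 π) := by
  obtain ⟨C, hC0, hC⟩ := exists_sobolevNorm_le hπ
  obtain ⟨M, hM⟩ := hπ.bounded
  refine Metric.complete_of_cauchySeq_tendsto fun ψ hψ => ?_
  have hcauchy : ∀ F : DotW22 π →ₗ[ℝ] L2 Ω, (∀ ψ, ‖F ψ‖ ≤ C * ‖ψ‖ ∨ ‖F ψ‖ ≤ ‖ψ‖) →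
      ∃ f, Filter.Tendsto (fun n => F (ψ n)) Filter.atTop (𝓝 f) := by
    intro F hF
    have hF' : ∀ ψ, ‖F ψ‖ ≤ (C + 1) * ‖ψ‖ := by
      intro ψ
      have := norm_nonneg ψ
      rcases hF ψ with h | h
      · nlinarith
      · nlinarith [mul_nonneg hC0 this]
    exact cauchySeq_tendsto_of_complete
      ((F.mkContinuous (C + 1) hF').uniformContinuous.comp_cauchySeq hψ)
  obtain ⟨u, hu⟩ := hcauchy (W22.toL2.comp DotW22.incl) fun ψ =>
    Or.inl ((norm_toL2_le_sobolevNorm _).trans (hC ψ))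
  choose v hv using fun i => hcauchy
    (((W12 Ω).subtype.comp (gradW i)).comp DotW22.incl) fun ψ =>
    Or.inl ((norm_gradW_le_sobolevNorm i _).trans (hC ψ))
  choose w hw using fun i j => hcauchy ((hessW i j).comp DotW22.incl) fun ψ =>
    Or.inr (norm_hessW_le ψ i j)
  have huv : ∀ i, HasWeakDeriv i u (v i) := fun i =>
    HasWeakDeriv.of_tendsto (fun n => hasWeakDeriv_gradW i (ψ n).incl) hu (hv i)
  have hvw : ∀ i j, HasWeakDeriv j (v i) (w i j) := fun i j =>
    HasWeakDeriv.of_tendsto (fun n => hasWeakDeriv_hessW i j (ψ n).incl) (hv i) (hw i j)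
  let u₁ : W12 Ω := ⟨u, fun i => ⟨v i, huv i⟩⟩
  have hu₁ : ∀ i, weakDeriv i u₁ = v i := fun i => (hasWeakDeriv_weakDeriv i u₁).unique (huv i)
  let u₂ : W22 Ω := ⟨u₁, (Submodule.mem_iInf _).2 fun i => by
    rw [Submodule.mem_comap, hu₁ i]; exact fun j => ⟨w i j, hvw i j⟩⟩
  have hg₂ : ∀ i, (gradW i u₂ : L2 Ω) = v i := hu₁
  have hh₂ : ∀ i j, hessW i j u₂ = w i j := fun i j =>
    (hasWeakDeriv_hessW i j u₂).unique (by rw [hg₂]; exact hvw i j)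
  have hsob : Filter.Tendsto (fun n => sobolevNorm ((ψ n).incl - u₂)) Filter.atTop (𝓝 0) := by
    unfold sobolevNorm
    simp only [map_sub, Submodule.coe_sub, hg₂, hh₂]
    have t0 := (tendsto_sub_nhds_zero_iff.2 hu).norm
    have t1 := fun i => (tendsto_sub_nhds_zero_iff.2 (hv i)).norm
    have t2 := fun i j => (tendsto_sub_nhds_zero_iff.2 (hw i j)).norm
    have := (t0.add (tendsto_finsetSum Finset.univ fun i _ => t1 i)).add
      (tendsto_finsetSum Finset.univ fun i _ => tendsto_finsetSum Finset.univ fun j _ => t2 i j)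
    simpa using! this
  have hker : π u₂ = 0 := by
    refine eq_zero_of_sobolevNorm_eq_zero ((ge_of_tendsto' (x := Filter.atTop)
      (f := fun n => M * sobolevNorm ((ψ n).incl - u₂)) (b := sobolevNorm (π u₂)) ?_
      fun n => ?_).antisymm (sobolevNorm_nonneg _))
    · simpa using hsob.const_mul M
    · have := hM ((ψ n).incl - u₂)
      rwa [map_sub, (ψ n).map_incl, zero_sub, sobolevNorm_neg] at this
  let ψ' : DotW22 π := ⟨u₂, LinearMap.mem_ker.2 hker⟩
  refine ⟨ψ', ?_⟩
  rw [tendsto_iff_norm_sub_tendsto_zero]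
  exact squeeze_zero (fun n => norm_nonneg _) (fun n => norm_le_sobolevNorm (ψ n - ψ')) hsob

/-- The space `Ẇ^{2,2}(Ω)` is nontrivial. -/
theorem DotW22.exists_ne_zero (hπ : IsAffineProjection π) : ∃ ψ : DotW22 π, ψ ≠ 0 := by
  have hq : ContDiff ℝ ∞ fun x : E3 => x 0 ^ 2 := by fun_prop
  have hd : ∀ x : E3, fderiv ℝ (fun x : E3 => x 0 ^ 2) x (EuclideanSpace.single 0 1) = 2 * x 0 := by
    intro x
    have h : HasFDerivAt (fun x : E3 => x 0 ^ 2)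
        ((2 * x 0) • (EuclideanSpace.proj 0 : E3 →L[ℝ] ℝ)) x := by
      simpa using ((EuclideanSpace.proj 0 : E3 →L[ℝ] ℝ).hasFDerivAt (x := x)).pow 2
    rw [h.fderiv]
    simp
  have hdd : ∀ x : E3, fderiv ℝ (fun x : E3 => fderiv ℝ (fun x : E3 => x 0 ^ 2) x
      (EuclideanSpace.single 0 1)) x (EuclideanSpace.single 0 1) = 2 := by
    intro x
    simp only [hd]
    have h : HasFDerivAt (fun x : E3 => 2 * x 0)
        ((2 : ℝ) • (EuclideanSpace.proj 0 : E3 →L[ℝ] ℝ)) x := by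
      simpa using ((EuclideanSpace.proj 0 : E3 →L[ℝ] ℝ).hasFDerivAt (x := x)).const_mul 2
    rw [h.fderiv]
    simp
  set q : W22 Ω := smoothW22 Ω _ hq
  have hfix : ∀ u, π (π u) = π u := fun u => hπ.fix (π u) (hπ.affine u)
  refine ⟨⟨q - π q, LinearMap.mem_ker.2 (by rw [map_sub, hfix, sub_self])⟩, fun h0 => ?_⟩
  have hqπ : q - π q = 0 := congrArg Subtype.val h0
  obtain ⟨a, b, hab⟩ := hπ.affine q
  have hqa : q = affineW22 Ω a b := by
    rw [sub_eq_zero.1 hqπ]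
    exact W22.toL2_injective (Lp.ext (hab.trans (toL2_affineW22 a b).symm))
  have hh := hessW_affineW22 (Ω := Ω) a b 0 0
  rw [← hqa, hessW_smoothW22] at hh
  have hae := coeFn_continuousL2 (Ω := Ω) (continuous_partial (contDiff_partial hq 0) 0)
  rw [hh] at hae
  have hfalse : ∀ᵐ x ∂Ω.vol, False := by
    filter_upwards [hae, Lp.coeFn_zero ℝ 2 Ω.vol] with x h1 h2
    rw [h2, hdd] at h1
    simp at h1
  rw [Filter.eventually_false_iff_eq_bot, ae_eq_bot, Measure.restrict_eq_zero] at hfalse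
  have := volume_real_pos Ω
  rw [Measure.real, hfalse] at this
  simp at this

theorem DotW12Vec.eq_zero_of_norm_eq_zero {w : DotW12Vec Ω} (h : ‖w‖ = 0) : w = 0 := by
  have h0 : DotW12Vec.jac w = 0 := norm_eq_zero.1 h
  funext i
  refine Subtype.ext (eq_zero_of_weakDeriv_eq_zero (w i).2 fun j => ?_)
  exact congrFun (congrArg (WithLp.ofLp) h0) (i, j)

/-- The continuous representative of a potential, on the closure of the domain. -/
def IsRep (ψ : DotW22 π) (g : E3 → ℝ) : Prop :=
  ContinuousOn g (closure Ω.set) ∧ W22.toL2 ψ.incl =ᵐ[Ω.vol] g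

theorem IsRep.unique {ψ : DotW22 π} {g g' : E3 → ℝ} (h : IsRep ψ g) (h' : IsRep ψ g') :
    Set.EqOn g g' (closure Ω.set) := by
  have hae : g =ᵐ[volume.restrict Ω.set] g' := h.2.symm.trans h'.2
  have := Measure.eqOn_open_of_ae_eq hae Ω.carrier.isOpen (h.1.mono subset_closure)
    (h'.1.mono subset_closure)
  exact this.of_subset_closure h.1 h'.1 subset_closure subset_rfl

theorem IsRep.add {ψ ψ' : DotW22 π} {g g' : E3 → ℝ} (h : IsRep ψ g) (h' : IsRep ψ' g') :
    IsRep (ψ + ψ') (fun x => g x + g' x) := by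
  refine ⟨h.1.add h'.1, ?_⟩
  rw [map_add, map_add]
  exact (Lp.coeFn_add _ _).trans (h.2.add h'.2)

theorem IsRep.smul {ψ : DotW22 π} {g : E3 → ℝ} (c : ℝ) (h : IsRep ψ g) :
    IsRep (c • ψ) (fun x => c * g x) := by
  refine ⟨continuousOn_const.mul h.1, ?_⟩
  rw [map_smul, map_smul]
  exact (Lp.coeFn_smul _ _).trans (h.2.const_smul c)

theorem exists_isEvaluation (hπ : IsAffineProjection π) : ∃ δ : EvalMap π, IsEvaluation δ := by
  obtain ⟨C, hC0, hC⟩ := exists_continuous_rep Ω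
  obtain ⟨C', hC0', hC'⟩ := exists_sobolevNorm_le hπ
  have hrep : ∀ ψ : DotW22 π, ∃ g : E3 → ℝ, IsRep ψ g ∧
      ∀ x ∈ closure Ω.set, |g x| ≤ C * C' * ‖ψ‖ := by
    intro ψ
    obtain ⟨g, hg, hψg, hb⟩ := hC (W22.toL2 ψ.incl) (fun i => (gradW i ψ.incl : L2 Ω))
      (fun i j => hessW i j ψ.incl) (fun i => hasWeakDeriv_gradW i _)
      (fun i j => hasWeakDeriv_hessW i j _)
    refine ⟨g, ⟨hg, hψg⟩, fun x hx => (hb x hx).trans ?_⟩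
    rw [norm22_eq_sobolevNorm, mul_assoc]
    exact mul_le_mul_of_nonneg_left (hC' ψ) hC0
  choose g hg hgb using hrep
  have hadd : ∀ ψ ψ', ∀ x ∈ closure Ω.set, g (ψ + ψ') x = g ψ x + g ψ' x := fun ψ ψ' x hx =>
    (hg (ψ + ψ')).unique ((hg ψ).add (hg ψ')) hx
  have hsmul : ∀ (c : ℝ) ψ, ∀ x ∈ closure Ω.set, g (c • ψ) x = c * g ψ x := fun c ψ x hx =>
    (hg (c • ψ)).unique ((hg ψ).smul c) hx
  have hev : ∀ S : Set E3, S ⊆ closure Ω.set → ∃ T : DotW22 π →L[ℝ] (S →ᵇ ℝ),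
      ∀ ψ, ∀ x : S, T ψ x = g ψ x := by
    intro S hS
    let T : DotW22 π →ₗ[ℝ] (S →ᵇ ℝ) :=
      { toFun := fun ψ => BoundedContinuousFunction.ofNormedAddCommGroup (fun x : S => g ψ x)
          (((hg ψ).1.mono hS).domRestrict) (C * C' * ‖ψ‖) fun x => hgb ψ x (hS x.2)
        map_add' := fun ψ ψ' => BoundedContinuousFunction.ext fun x => hadd ψ ψ' x (hS x.2)
        map_smul' := fun c ψ => BoundedContinuousFunction.ext fun x => hsmul c ψ x (hS x.2) }
    refine ⟨T.mkContinuous (C * C') fun ψ => ?_, fun ψ x => rfl⟩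
    exact (BoundedContinuousFunction.norm_le (by positivity)).2 fun x => hgb ψ x (hS x.2)
  obtain ⟨T₁, hT₁⟩ := hev Ω.set subset_closure
  obtain ⟨T₂, hT₂⟩ := hev (frontier Ω.set) frontier_subset_closure
  exact ⟨T₁.prod T₂, fun ψ => ⟨g ψ, (hg ψ).1, (hg ψ).2, hT₁ ψ, hT₂ ψ⟩⟩

section Hilbert

variable {E : Type*} [SeminormedAddCommGroup E] [InnerProductSpace ℝ E] [CompleteSpace E]
  [T0Space E]

/-- The Riesz representation of bounded functionals, for a separated complete seminormed space. -/
theorem exists_riesz : ∃ R : StrongDual ℝ E →L[ℝ] E, (∀ ℓ x, inner ℝ (R ℓ) x = ℓ x) ∧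
    ∀ ℓ, ‖R ℓ‖ = ‖ℓ‖ := by
  let _ : NormedAddCommGroup E := NormedAddCommGroup.ofSeparation fun x hx => by
    have : Inseparable x 0 := Metric.inseparable_iff.2 (by rw [dist_zero_right]; exact hx)
    exact this.eq
  let R : StrongDual ℝ E →ₗ[ℝ] E :=
    { toFun := (InnerProductSpace.toDual ℝ E).symm
      map_add' := map_add _
      map_smul' := fun c ℓ => by simp }
  refine ⟨R.mkContinuous 1 fun ℓ => ?_, ?_, ?_⟩
  · rw [one_mul]
    exact ((InnerProductSpace.toDual ℝ E).symm.norm_map ℓ).le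
  · intro ℓ x
    exact InnerProductSpace.toDual_symm_apply
  · intro ℓ
    exact (InnerProductSpace.toDual ℝ E).symm.norm_map ℓ

theorem isLUB_div_norm (ℓ : StrongDual ℝ E) (hE : ∃ x : E, x ≠ 0)
    (h0 : ∀ x : E, ‖x‖ = 0 → x = 0) :
    IsLUB {r : ℝ | ∃ x : E, x ≠ 0 ∧ r = ℓ x / ‖x‖} ‖ℓ‖ := by
  obtain ⟨R, hR, hRn⟩ := exists_riesz (E := E)
  have hpos : ∀ x : E, x ≠ 0 → 0 < ‖x‖ := fun x hx =>
    (norm_nonneg x).lt_of_ne fun h => hx (h0 x h.symm)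
  constructor
  · rintro _ ⟨x, hx, rfl⟩
    rw [div_le_iff₀ (hpos x hx)]
    exact (le_abs_self _).trans (ℓ.le_opNorm x)
  · intro b hb
    by_cases hR0 : R ℓ = 0
    · have hℓ : ‖ℓ‖ = 0 := by rw [← hRn, hR0, norm_zero]
      obtain ⟨x, hx⟩ := hE
      have hx0 : ℓ x = 0 := by rw [← hR, hR0, inner_zero_left]
      have := hb ⟨x, hx, rfl⟩
      rw [hx0, zero_div] at this
      rwa [hℓ]
    · refine hb ⟨R ℓ, hR0, ?_⟩
      rw [← hR, real_inner_self_eq_norm_sq, sq, mul_div_assoc, div_self (hpos _ hR0).ne', mul_one,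
        hRn]

end Hilbert

theorem dissipation_eq (w : DotW12Vec Ω) : dissipation w = ‖w‖ ^ 2 := by
  rw [← real_inner_self_eq_norm_sq, inner_dotW12Vec]
  rfl

theorem sum_hess_eq (ψ : DotW22 π) :
    ∑ i, ∑ j, ∫ x in Ω.set, hessW i j ψ.incl x * hessW i j ψ.incl x = ‖ψ‖ ^ 2 := by
  rw [← real_inner_self_eq_norm_sq, inner_dotW22]

theorem weakBalance_iff (δ : EvalMap π) (β : SignedMeasure Ω.set)
    (τ : SignedMeasure (frontier Ω.set)) (w : DotW12Vec Ω) :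
    WeakBalance δ β τ w ↔
      ∀ ψ, deltaStar δ (hatPair β τ) ψ = inner ℝ w (gradDot π ψ) :=
  ContinuousLinearMap.ext_iff

theorem exists_optimal (hπ : IsAffineProjection π) (δ : EvalMap π) (β : SignedMeasure Ω.set)
    (τ : SignedMeasure (frontier Ω.set)) :
    ∃ w, WeakBalance δ β τ w ∧ ‖w‖ = ‖deltaStar δ (hatPair β τ)‖ ∧
      ∀ w', WeakBalance δ β τ w' → dissipation w' = dissipation w + dissipation (w' - w) := by
  have := DotW22.t0Space hπ
  have := DotW22.completeSpace hπ
  obtain ⟨R, hR, hRn⟩ := exists_riesz (E := DotW22 π)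
  set ψ₀ := R (deltaStar δ (hatPair β τ))
  have hbal : WeakBalance δ β τ (gradDot π ψ₀) := (weakBalance_iff _ _ _ _).2 fun ψ => by
    rw [(gradDot π).inner_map_map, hR]
  refine ⟨gradDot π ψ₀, hbal, by rw [(gradDot π).norm_map, hRn], fun w' hw' => ?_⟩
  have horth : inner ℝ (w' - gradDot π ψ₀) (gradDot π ψ₀) = 0 := by
    rw [inner_sub_left, ← (weakBalance_iff _ _ _ _).1 hw', ← (weakBalance_iff _ _ _ _).1 hbal,
      sub_self]
  simp only [dissipation_eq]
  have := norm_add_sq_real (w' - gradDot π ψ₀) (gradDot π ψ₀)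
  rw [horth, sub_add_cancel] at this
  linarith

theorem existsUnique_optimal (hπ : IsAffineProjection π) (δ : EvalMap π)
    (β : SignedMeasure Ω.set) (τ : SignedMeasure (frontier Ω.set)) :
    ∃ w, IsOptimalFlux δ β τ w ∧ ‖w‖ = ‖deltaStar δ (hatPair β τ)‖ ∧
      ∀ w', IsOptimalFlux δ β τ w' → w' = w := by
  obtain ⟨w, hw, hn, hpyth⟩ := exists_optimal hπ δ β τ
  have hmin : ∀ w', WeakBalance δ β τ w' → dissipation w ≤ dissipation w' := fun w' hw' => by
    rw [hpyth w' hw', dissipation_eq (w' - w)]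
    exact le_add_of_nonneg_right (sq_nonneg _)
  refine ⟨w, ⟨hw, hmin⟩, hn, fun w' hw' => ?_⟩
  have h1 := hpyth w' hw'.1
  have h2 := hw'.2 w hw
  rw [dissipation_eq (w' - w)] at h1
  have h3 : ‖w' - w‖ ^ 2 = 0 := le_antisymm (by linarith) (sq_nonneg _)
  exact sub_eq_zero.1 (DotW12Vec.eq_zero_of_norm_eq_zero (pow_eq_zero_iff two_ne_zero |>.1 h3))

theorem IsOptimalFlux.optimalValue_eq {δ : EvalMap π} {β : SignedMeasure Ω.set}
    {τ : SignedMeasure (frontier Ω.set)} {w : DotW12Vec Ω} (h : IsOptimalFlux δ β τ w) :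
    optimalValue δ β τ = ‖w‖ := by
  have hsqrt : ∀ w : DotW12Vec Ω, √(dissipation w) = ‖w‖ := fun w => by
    rw [dissipation_eq, Real.sqrt_sq (norm_nonneg _)]
  refine IsLeast.csInf_eq ⟨⟨w, h.1, (hsqrt w).symm⟩, ?_⟩
  rintro _ ⟨w', hw', rfl⟩
  rw [← hsqrt w]
  exact Real.sqrt_le_sqrt (h.2 w' hw')

variable (π) in
/-- The mapping `δ^*` is a bounded linear operator. -/
theorem exists_deltaStar_clm (δ : EvalMap π) :
    ∃ T : StrongDual ℝ (Ω.set →ᵇ ℝ) × StrongDual ℝ (frontier Ω.set →ᵇ ℝ) →L[ℝ]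
      StrongDual ℝ (DotW22 π), ∀ F, T F = deltaStar δ F := by
  let T₁ : StrongDual ℝ (Ω.set →ᵇ ℝ) →L[ℝ] StrongDual ℝ (DotW22 π) :=
    (ContinuousLinearMap.compL ℝ (DotW22 π) (Ω.set →ᵇ ℝ) ℝ).flip
      ((ContinuousLinearMap.fst ℝ _ _).comp δ)
  let T₂ : StrongDual ℝ (frontier Ω.set →ᵇ ℝ) →L[ℝ] StrongDual ℝ (DotW22 π) :=
    (ContinuousLinearMap.compL ℝ (DotW22 π) (frontier Ω.set →ᵇ ℝ) ℝ).flip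
      ((ContinuousLinearMap.snd ℝ _ _).comp δ)
  exact ⟨T₁.coprod T₂, fun F => rfl⟩

end FluxOpt

end

theorem mainTheorem3 (Ω : LipschitzDomain) (π : W22 Ω →ₗ[ℝ] W22 Ω) (hπ : IsAffineProjection π) :
    ∃ δ : EvalMap π, IsEvaluation δ ∧
    ∃ (δT : StrongDual ℝ (Ω.set →ᵇ ℝ) × StrongDual ℝ (frontier Ω.set →ᵇ ℝ) →L[ℝ] DotW22 π)
      (gradT : DotW12Vec Ω →L[ℝ] DotW22 π),
      (∀ F ψ, inner ℝ (δT F) ψ = deltaStar δ F ψ) ∧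
      (∀ w ψ, inner ℝ (gradT w) ψ = inner ℝ w (gradDot π ψ)) ∧
      ∀ (β : SignedMeasure Ω.set) (τ : SignedMeasure (frontier Ω.set)),
        (∀ w, WeakBalance δ β τ w ↔ δT (hatPair β τ) = gradT w) ∧
        (∃! w, IsOptimalFlux δ β τ w) ∧
        ∀ w, IsOptimalFlux δ β τ w →
          optimalValue δ β τ = ‖w‖ ∧
          optimalValue δ β τ ^ 2 = dissipation w ∧
          optimalValue δ β τ = ‖deltaStar δ (hatPair β τ)‖ ∧
          IsLUB {r : ℝ | ∃ ψ : DotW22 π, ψ ≠ 0 ∧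
            r = (β.integral (fun x => (δ ψ).1 x) (ContinuousLinearMap.lsmul ℝ ℝ) +
                τ.integral (fun x => (δ ψ).2 x) (ContinuousLinearMap.lsmul ℝ ℝ)) /
              √(∑ i, ∑ j, ∫ x in Ω.set, hessW i j ψ.incl x * hessW i j ψ.incl x)}
            (optimalValue δ β τ) := by
  obtain ⟨δ, hδ⟩ := exists_isEvaluation hπ
  have := DotW22.t0Space hπ
  have := DotW22.completeSpace hπ
  obtain ⟨R, hR, -⟩ := exists_riesz (E := DotW22 π)
  obtain ⟨T, hT⟩ := exists_deltaStar_clm π δ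
  obtain ⟨G, hG⟩ : ∃ G : DotW12Vec Ω →L[ℝ] StrongDual ℝ (DotW22 π),
      ∀ w ψ, G w ψ = inner ℝ w (gradDot π ψ) :=
    ⟨((ContinuousLinearMap.compL ℝ (DotW22 π) (DotW12Vec Ω) ℝ).flip
      (gradDot π).toContinuousLinearMap).comp (innerSL ℝ), fun w ψ => rfl⟩
  have hδT : ∀ F ψ, inner ℝ ((R.comp T) F) ψ = deltaStar δ F ψ := fun F ψ => by
    rw [← hT]; exact hR _ _
  have hgT : ∀ w ψ, inner ℝ ((R.comp G) w) ψ = inner ℝ w (gradDot π ψ) := fun w ψ => by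
    rw [← hG]; exact hR _ _
  refine ⟨δ, hδ, R.comp T, R.comp G, hδT, hgT, fun β τ => ⟨fun w => ?_, ?_, fun w hw => ?_⟩⟩
  · rw [weakBalance_iff]
    constructor
    · intro h
      refine sub_eq_zero.1 (DotW22.eq_zero_of_norm_eq_zero hπ ?_)
      rw [← sq_eq_zero_iff, ← real_inner_self_eq_norm_sq, inner_sub_left, hδT, hgT, h, sub_self]
    · intro h ψ
      rw [← hδT, h, hgT]
  · obtain ⟨w, hw, -, huniq⟩ := existsUnique_optimal hπ δ β τ
    exact ⟨w, hw, huniq⟩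
  · have hval := hw.optimalValue_eq
    have hnorm : ‖w‖ = ‖deltaStar δ (hatPair β τ)‖ := by
      obtain ⟨w', -, hn, huniq⟩ := existsUnique_optimal hπ δ β τ
      rw [huniq w hw, hn]
    refine ⟨hval, by rw [hval, dissipation_eq], hval.trans hnorm, ?_⟩
    rw [hval, hnorm]
    have hlub := isLUB_div_norm (deltaStar δ (hatPair β τ)) (DotW22.exists_ne_zero hπ)
      fun ψ => DotW22.eq_zero_of_norm_eq_zero hπ
    convert hlub using 5 with r ψ
    rw [sum_hess_eq, Real.sqrt_sq (norm_nonneg _)]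
    rfl
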